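/- Let $M$ be an $n$-dimensional smooth manifold with a distance that induces its topology and for which closed balls are compact, and let $\lambda$ be a volume measure on $M$ (a Borel measure with positive continuous density with respect to Lebesgue measure in every chart). Let $X_1,\dots,X_m$ be smooth vector fields, $\nabla\varphi=(X_1\varphi,\dots,X_m\varphi)$ the corresponding (sub)gradient and $|\nabla\varphi|$ its Euclidean length. A test function is a function $M\to\mathbb R$ that is differentiable $\lambda$-a.e. and is smooth or locally Lipschitz for the distance. The distance is assumed to be compatible with $\nabla$: for some $L<\infty$, every test function $\varphi$ with $|\nabla\varphi|\le 1$ a.e. is $L$-Lipschitz (that is, the intrinsic distance of $\nabla$ is at most $L$ times the distance). Examples are $\mathbb R^n$ with the Euclidean distance and the Heisenberg group with the Carnot–Carathéodory distance. Fix $x_0\in M$, let $d(x)$ be the distance from $x_0$ to $x$, and $B_R=\{d<R\}$. Assume: (i) for some $\sigma\ge1$, $\frac1\sigma<|\nabla d|\le 1$ $\lambda$-a.e.; (ii) for some $K>0$, $\Delta d\le K$ on $\{d>1\}$ in the weak sense: $-\int\nabla d\cdot\nabla\varphi\,d\lambda\le K\int\varphi\,d\lambda$ for every nonnegative test function $\varphi$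 with compact support contained in $\{d>1\}$ for which $\nabla d\cdot\nabla\varphi$ is $\lambda$-integrable; (iii) for some $\epsilon,\alpha,\beta>0$, $\left(\int|\varphi|^{2+\epsilon}d\lambda\right)^{\frac2{2+\epsilon}}\le\alpha\int|\nabla\varphi|^2d\lambda+\beta\int|\varphi|^2d\lambda$ for all compactly supported test functions $\varphi$; (iv) for every $R>0$ there is $c_R<\infty$ such that $\frac1{\lambda(B_R)}\int_{B_R}\left|\varphi-\frac1{\lambda(B_R)}\int_{B_R}\varphi\,d\lambda\right|^2d\lambda\le \frac{c_R}{\lambda(B_R)}\int_{B_R}|\nabla\varphi|^2d\lambda$ for all test functions $\varphi$. Then there is $\delta_0\in(0,1)$ such that the following holds. Let $q>2$, $1<p<2$, $p\ge\frac q{q-1}$, $0<\delta\le\delta_0$, $\gamma_\delta>0$, and let $W$ be a test function with $|\nabla W|\le\delta d^{p-1}+\gamma_\delta$ $\lambda$-a.e. Let $d\mu_p=\frac{e^{-d^p}}{Z_p}d\lambda$ and $d\mu=\frac{e^{-W}}{Z}d\mu_p$, where $Z_p$ and $Z$ are normalization constants, and suppose that $\mu$ is a probability measure. With $H_q(x)=x^2$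 for $|x|\le1$ and $H_q(x)=|x|^q$ for $|x|\ge1$, there is a constant $c>0$ such that $$\int f^2\log\frac{f^2}{\int f^2d\mu}\,d\mu\le c\int H_q\!\left(\frac{|\nabla f|}{f}\right)f^2\,d\mu$$ for every test function $f\in L^2(\mu)$, in particular for every $f\in C^\infty(M)\cap L^2(\mu)$. (The integrand on the right is read as $0$ where $f=0$; if the right side is finite, $f^2\log\frac{f^2}{\int f^2d\mu}$ is $\mu$-integrable.) -/

import Mathlib

open MeasureTheory Set
open scoped Manifold ContDiff ENNReal NNReal

noncomputable section

/-- The (sub)gradient `∇φ = (X₁ φ, …, X_m φ)` of a real function, for a finite family of vector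
fields `X₁, …, X_m`. Its Euclidean norm is `|∇φ|`. -/
def subgrad {n m : ℕ} {M : Type*} [TopologicalSpace M] [ChartedSpace (EuclideanSpace ℝ (Fin n)) M]
    (X : Fin m → (x : M) → TangentSpace 𝓘(ℝ, EuclideanSpace ℝ (Fin n)) x)
    (φ : M → ℝ) (x : M) : EuclideanSpace ℝ (Fin m) :=
  WithLp.toLp 2 fun i =>
    (mfderiv 𝓘(ℝ, EuclideanSpace ℝ (Fin n)) 𝓘(ℝ, ℝ) φ x (X i x) : ℝ)

/-- The functions on which the inequalities are tested: functions that are smooth or locally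
Lipschitz for the distance, and differentiable almost everywhere. -/
def IsTestFunction (n : ℕ) {M : Type*} [MetricSpace M]
    [ChartedSpace (EuclideanSpace ℝ (Fin n)) M] [MeasurableSpace M]
    (ν : Measure M) (φ : M → ℝ) : Prop :=
  (ContMDiff 𝓘(ℝ, EuclideanSpace ℝ (Fin n)) 𝓘(ℝ, ℝ) ∞ φ ∨ LocallyLipschitz φ) ∧
    ∀ᵐ x ∂ν, MDifferentiableAt 𝓘(ℝ, EuclideanSpace ℝ (Fin n)) 𝓘(ℝ, ℝ) φ x

/-- `lam` is a volume (Lebesgue) measure on the `n`-dimensional manifold `M`: in each chart it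
has a positive continuous density with respect to the Lebesgue measure of `ℝⁿ`. -/
def IsVolume (n : ℕ) {M : Type*} [TopologicalSpace M]
    [ChartedSpace (EuclideanSpace ℝ (Fin n)) M] [MeasurableSpace M] (lam : Measure M) : Prop :=
  ∀ e ∈ atlas (EuclideanSpace ℝ (Fin n)) M, ∃ ρ : EuclideanSpace ℝ (Fin n) → ℝ,
    ContinuousOn ρ e.target ∧ (∀ y ∈ e.target, 0 < ρ y) ∧
      ∀ s : Set M, MeasurableSet s → s ⊆ e.source →
        lam s = ∫⁻ y in e '' s, ENNReal.ofReal (ρ y)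

/-- The intrinsic distance of the (sub)gradient:
`sup {|φ x - φ y| : |∇φ| ≤ 1 almost everywhere}`. -/
def intrinsicEDist {n m : ℕ} {M : Type*} [MetricSpace M]
    [ChartedSpace (EuclideanSpace ℝ (Fin n)) M] [MeasurableSpace M]
    (X : Fin m → (x : M) → TangentSpace 𝓘(ℝ, EuclideanSpace ℝ (Fin n)) x)
    (lam : Measure M) (x y : M) : ℝ≥0∞ :=
  ⨆ (φ : M → ℝ) (_ : IsTestFunction n lam φ) (_ : ∀ᵐ z ∂lam, ‖subgrad X φ z‖ ≤ 1),
    edist (φ x) (φ y)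

/-- `Δu ≤ K` on the set `A` in the weak sense, where `Δ = - ∇* ∇` with respect to `lam`:
`- ∫ ∇u · ∇φ dλ ≤ K ∫ φ dλ` for all nonnegative compactly supported `φ` with support in `A`. -/
def LaplacianLEOn {n m : ℕ} {M : Type*} [MetricSpace M]
    [ChartedSpace (EuclideanSpace ℝ (Fin n)) M] [MeasurableSpace M]
    (X : Fin m → (x : M) → TangentSpace 𝓘(ℝ, EuclideanSpace ℝ (Fin n)) x)
    (lam : Measure M) (u : M → ℝ) (A : Set M) (K : ℝ) : Prop :=
  ∀ φ : M → ℝ, IsTestFunction n lam φ → HasCompactSupport φ → tsupport φ ⊆ A →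
    (∀ x, 0 ≤ φ x) →
    Integrable (fun x => inner ℝ (subgrad X u x) (subgrad X φ x)) lam →
      -(∫ x, inner ℝ (subgrad X u x) (subgrad X φ x) ∂lam) ≤ K * ∫ x, φ x ∂lam

/-- The classical Sobolev inequality
`(∫ |φ|^(2+ε) dλ)^(2/(2+ε)) ≤ α ∫ |∇φ|² dλ + β ∫ |φ|² dλ` for compactly supported `φ`. -/
def ClassicalSobolev {n m : ℕ} {M : Type*} [MetricSpace M]
    [ChartedSpace (EuclideanSpace ℝ (Fin n)) M] [MeasurableSpace M]
    (X : Fin m → (x : M) → TangentSpace 𝓘(ℝ, EuclideanSpace ℝ (Fin n)) x)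
    (lam : Measure M) (ε α β : ℝ) : Prop :=
  ∀ φ : M → ℝ, IsTestFunction n lam φ → HasCompactSupport φ →
    (∫⁻ x, ‖φ x‖ₑ ^ (2 + ε) ∂lam) ^ (2 / (2 + ε)) ≤
      ENNReal.ofReal α * (∫⁻ x, ‖subgrad X φ x‖ₑ ^ 2 ∂lam) +
        ENNReal.ofReal β * ∫⁻ x, ‖φ x‖ₑ ^ 2 ∂lam

/-- The local Poincaré inequality on the balls `B_R = {d < R}` around `x₀`, with a constant
that may depend on the radius. -/
def LocalPoincare {n m : ℕ} {M : Type*} [MetricSpace M]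
    [ChartedSpace (EuclideanSpace ℝ (Fin n)) M] [MeasurableSpace M]
    (X : Fin m → (x : M) → TangentSpace 𝓘(ℝ, EuclideanSpace ℝ (Fin n)) x)
    (lam : Measure M) (x₀ : M) : Prop :=
  ∀ R : ℝ, 0 < R → ∃ c : ℝ, 0 < c ∧ ∀ φ : M → ℝ, IsTestFunction n lam φ →
    ⨍⁻ x in Metric.ball x₀ R, ‖φ x - ⨍ y in Metric.ball x₀ R, φ y ∂lam‖ₑ ^ 2 ∂lam ≤
      ENNReal.ofReal c * ⨍⁻ x in Metric.ball x₀ R, ‖subgrad X φ x‖ₑ ^ 2 ∂lam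

/-- The modification `H_q` of `|x|^q`: it is `x²` for `|x| ≤ 1` and `|x|^q` for `|x| ≥ 1`. -/
def Hq (q x : ℝ) : ℝ := if |x| ≤ 1 then x ^ 2 else |x| ^ q

/-- The (tight) modified logarithmic Sobolev inequality `MLS(H_q)` for `μ`:
`∫ f² log (f² / ∫ f² dμ) dμ ≤ c ∫ H_q(|∇f| / f) f² dμ`, with `c` independent of `f`.
There is nothing to prove when the nonnegative integrand on the right is not integrable; when it
is, the left-hand side is part of the claim as an integrable function. Where `f = 0`, the integrand
on the right is read as `0`; for an absolutely continuous `μ` this is harmless, as `∇f` vanishes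
almost everywhere on `{f = 0}`. -/
def ModifiedLogSobolev {n m : ℕ} {M : Type*} [MetricSpace M]
    [ChartedSpace (EuclideanSpace ℝ (Fin n)) M] [MeasurableSpace M]
    (X : Fin m → (x : M) → TangentSpace 𝓘(ℝ, EuclideanSpace ℝ (Fin n)) x)
    (μ : Measure M) (q : ℝ) : Prop :=
  ∃ c : ℝ, 0 < c ∧ ∀ f : M → ℝ, IsTestFunction n μ f → MemLp f 2 μ →
    Integrable (fun x => Hq q (‖subgrad X f x‖ / f x) * f x ^ 2) μ →
      Integrable (fun x => f x ^ 2 * Real.log (f x ^ 2 / ∫ y, f y ^ 2 ∂μ)) μ ∧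
      ∫ x, f x ^ 2 * Real.log (f x ^ 2 / ∫ y, f y ^ 2 ∂μ) ∂μ ≤
        c * ∫ x, Hq q (‖subgrad X f x‖ / f x) * f x ^ 2 ∂μ

/-- The measure `dμ_p = e^{-d^p} dλ / Z_p`, with `d` the distance from `x₀`. -/
def muP {M : Type*} [MetricSpace M] [MeasurableSpace M] (lam : Measure M) (x₀ : M) (p : ℝ) :
    Measure M :=
  lam.tilted fun x => -(dist x₀ x ^ p)

end

/-!
Write `d` for the distance from `x₀` and `U = d ^ p + W`, so that the measure is `e^{-U} dλ`.
Testing `Δd ≤ K` against `e^{-U} ψ` and using `∇d · ∇U ≥ c d^{p-1} - γ`, which is where `|∇d|` must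
be bounded below and `δ` small, gives the U-bound `∫ |ψ| d^{p-1} dμ ≤ C ∫ (|∇ψ| + |ψ|) dμ`.
Applied to `ψ = f²`, it bounds the mass of `f²` far from `x₀`, and with the local Poincaré
inequality on a large ball it yields a Poincaré inequality for `μ`. The Sobolev inequality for
`f e^{-U/2}` yields a logarithmic Sobolev inequality whose defect involves `|∇U|² ≲ 1 + d^{2(p-1)}`
and `U ≲ 1 + d^p`, and the U-bound for `ψ = f² d` controls `f² d^p` by
`f |∇f| d + f²`; Young's inequality with exponents `p` and `p' = p / (p - 1) ≤ q` turns this into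
the `H_q` energy. The defect is removed by applying the inequality to a truncation of `f` that
vanishes for `f² ≤ 2`, whose mass the Poincaré inequality controls once `∫ f² dμ = 1`.
-/

open Filter Topology

section Calculus

variable {n m : ℕ} {M : Type*} [TopologicalSpace M] [ChartedSpace (EuclideanSpace ℝ (Fin n)) M]
  {X : Fin m → (x : M) → TangentSpace (𝓡 n) x} {f g : M → ℝ} {x : M}

lemma subgrad_comp {Φ : ℝ → ℝ} {c : ℝ} (hf : MDifferentiableAt (𝓡 n) 𝓘(ℝ, ℝ) f x)
    (hΦ : HasDerivAt Φ c (f x)) :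
    subgrad X (fun y => Φ (f y)) x = c • subgrad X f x := by
  have h := (hΦ.hasFDerivAt.hasMFDerivAt.comp x hf.hasMFDerivAt).mfderiv
  ext i
  change mfderiv _ _ (Φ ∘ f) x (X i x) = c * _
  rw [h]
  exact mul_comm (G := ℝ) (mfderiv (𝓡 n) 𝓘(ℝ, ℝ) f x (X i x)) c

lemma subgrad_add (hf : MDifferentiableAt (𝓡 n) 𝓘(ℝ, ℝ) f x)
    (hg : MDifferentiableAt (𝓡 n) 𝓘(ℝ, ℝ) g x) :
    subgrad X (fun y => f y + g y) x = subgrad X f x + subgrad X g x := by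
  have h := (hf.hasMFDerivAt.add hg.hasMFDerivAt).mfderiv
  ext i
  change mfderiv _ _ (f + g) x (X i x) = _
  rw [h]
  rfl

lemma subgrad_mul (hf : MDifferentiableAt (𝓡 n) 𝓘(ℝ, ℝ) f x)
    (hg : MDifferentiableAt (𝓡 n) 𝓘(ℝ, ℝ) g x) :
    subgrad X (fun y => f y * g y) x = f x • subgrad X g x + g x • subgrad X f x := by
  have h := (hf.hasMFDerivAt.mul hg.hasMFDerivAt).mfderiv
  ext i
  change mfderiv _ _ (f * g) x (X i x) = _
  rw [h]
  rfl

lemma mdifferentiableAt_of_subgrad_ne_zero (h : subgrad X f x ≠ 0) :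
    MDifferentiableAt (𝓡 n) 𝓘(ℝ, ℝ) f x := by
  contrapose! h
  ext i
  change mfderiv _ _ f x (X i x) = 0
  rw [mfderiv_zero_of_not_mdifferentiableAt h]
  rfl

lemma support_subgrad_subset : Function.support (subgrad X f) ⊆ tsupport f := by
  intro x
  contrapose
  intro hx
  rw [Function.notMem_support]
  ext i
  change mfderiv _ _ f x (X i x) = 0
  have h : f =ᶠ[𝓝 x] fun _ => (0 : ℝ) := notMem_tsupport_iff_eventuallyEq.1 hx
  rw [h.mfderiv_eq, mfderiv_const]
  rfl

variable [IsManifold (𝓡 n) 1 M]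

lemma continuous_subgrad (hX : ∀ i, Continuous fun x => (⟨x, X i x⟩ : TangentBundle (𝓡 n) M))
    (hf : ContMDiff (𝓡 n) 𝓘(ℝ, ℝ) 1 f) : Continuous (subgrad X f) := by
  refine (PiLp.continuous_toLp 2 _).comp (continuous_pi fun i => ?_)
  have h : Continuous fun x => tangentMap (𝓡 n) 𝓘(ℝ, ℝ) f ⟨x, X i x⟩ :=
    (hf.continuous_tangentMap le_rfl).comp (hX i)
  exact continuous_snd.comp ((tangentBundleModelSpaceHomeomorph 𝓘(ℝ, ℝ)).continuous.comp h)

/-- The coordinates of the tangent vector `v` at `x` in the chart around `x₁`. -/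
noncomputable def chartVector (x₁ x : M) (v : TangentSpace (𝓡 n) x) : EuclideanSpace ℝ (Fin n) :=
  (trivializationAt (EuclideanSpace ℝ (Fin n)) (TangentSpace (𝓡 n)) x₁ ⟨x, v⟩).2

lemma mfderiv_apply_eq_fderiv_chart {x₁ : M}
    (hx : x ∈ (chartAt (EuclideanSpace ℝ (Fin n)) x₁).source)
    (hf : MDifferentiableAt (𝓡 n) 𝓘(ℝ, ℝ) f x) (v : TangentSpace (𝓡 n) x) :
    mfderiv (𝓡 n) 𝓘(ℝ, ℝ) f x v =
      fderiv ℝ (f ∘ (extChartAt (𝓡 n) x₁).symm) (extChartAt (𝓡 n) x₁ x) (chartVector x₁ x v) := by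
  set e := extChartAt (𝓡 n) x₁ with he
  have hxe : x ∈ e.source := by rwa [he, extChartAt_source]
  have hsymm : MDifferentiableAt (𝓡 n) (𝓡 n) e.symm (e x) := by
    have := mdifferentiableWithinAt_extChartAt_symm (I := 𝓡 n) (x := x₁) (e.map_source hxe)
    rwa [(𝓡 n).range_eq_univ, mdifferentiableWithinAt_univ] at this
  have hfe : MDifferentiableAt (𝓡 n) 𝓘(ℝ, ℝ) (f ∘ e.symm) (e x) :=
    MDifferentiableAt.comp (I' := 𝓡 n) _ (by rwa [e.left_inv hxe]) hsymm
  have hchain : mfderiv (𝓡 n) 𝓘(ℝ, ℝ) f x = (mfderiv (𝓡 n) 𝓘(ℝ, ℝ) (f ∘ e.symm) (e x)).comp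
      (mfderiv (𝓡 n) (𝓡 n) e x) := by
    rw [← mfderiv_comp x hfe (mdifferentiableAt_extChartAt hx)]
    apply Filter.EventuallyEq.mfderiv_eq
    filter_upwards [extChartAt_source_mem_nhds' (I := 𝓡 n) hxe] with z hz
    simp only [Function.comp_apply, e.left_inv hz]
  have hchart : mfderiv (𝓡 n) (𝓡 n) e x v = chartVector x₁ x v := by
    have h := DFunLike.congr_fun (TangentBundle.continuousLinearMapAt_trivializationAt hx) v
    rw [Bundle.Trivialization.continuousLinearMapAt_apply,
      Bundle.Trivialization.linearMapAt_apply] at h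
    exact h.symm.trans (if_pos (by simpa using hx))
  refine (DFunLike.congr_fun hchain v).trans ?_
  rw [← hchart, ← mfderiv_eq_fderiv]
  rfl

lemma continuousOn_chartVector {V : (x : M) → TangentSpace (𝓡 n) x}
    (hV : Continuous fun x => (⟨x, V x⟩ : TangentBundle (𝓡 n) M)) (x₁ : M) :
    ContinuousOn (fun x => chartVector x₁ x (V x))
      (chartAt (EuclideanSpace ℝ (Fin n)) x₁).source := by
  intro x hx
  have hmem : (⟨x, V x⟩ : TangentBundle (𝓡 n) M) ∈
      (trivializationAt (EuclideanSpace ℝ (Fin n)) (TangentSpace (𝓡 n)) x₁).source := by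
    rw [Bundle.Trivialization.mem_source]
    simpa using hx
  exact (ContinuousAt.comp (f := fun x => (⟨x, V x⟩ : TangentBundle (𝓡 n) M))
    ((trivializationAt _ _ x₁).continuousAt hmem) hV.continuousAt).snd.continuousWithinAt

variable [MeasurableSpace M] [BorelSpace M] {ν : Measure M}

lemma aemeasurable_restrict_mfderiv_apply {V : (x : M) → TangentSpace (𝓡 n) x}
    (hV : Continuous fun x => (⟨x, V x⟩ : TangentBundle (𝓡 n) M))
    (hf : ∀ᵐ x ∂ν, MDifferentiableAt (𝓡 n) 𝓘(ℝ, ℝ) f x) (x₁ : M) :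
    AEMeasurable (fun x => (mfderiv (𝓡 n) 𝓘(ℝ, ℝ) f x (V x) : ℝ))
      (ν.restrict (chartAt (EuclideanSpace ℝ (Fin n)) x₁).source) := by
  have hs := (chartAt (EuclideanSpace ℝ (Fin n)) x₁).open_source.measurableSet
  have hchart : AEMeasurable (extChartAt (𝓡 n) x₁)
      (ν.restrict (chartAt (EuclideanSpace ℝ (Fin n)) x₁).source) := by
    have := continuousOn_extChartAt (I := 𝓡 n) x₁
    rw [extChartAt_source] at this
    exact this.aemeasurable hs
  have hcoord : AEMeasurable (fun x => fderiv ℝ (f ∘ (extChartAt (𝓡 n) x₁).symm)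
      (extChartAt (𝓡 n) x₁ x) (chartVector x₁ x (V x)))
      (ν.restrict (chartAt (EuclideanSpace ℝ (Fin n)) x₁).source) :=
    isBoundedBilinearMap_apply.continuous.measurable.comp_aemeasurable
      (((measurable_fderiv ℝ _).comp_aemeasurable hchart).prodMk
        ((continuousOn_chartVector hV x₁).aemeasurable hs))
  refine hcoord.congr ?_
  filter_upwards [ae_restrict_of_ae hf, ae_restrict_mem hs] with x hfx hx
  exact (mfderiv_apply_eq_fderiv_chart hx hfx (V x)).symm

lemma aemeasurable_subgrad [SecondCountableTopology M]
    (hX : ∀ i, Continuous fun x => (⟨x, X i x⟩ : TangentBundle (𝓡 n) M))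
    (hf : ∀ᵐ x ∂ν, MDifferentiableAt (𝓡 n) 𝓘(ℝ, ℝ) f x) : AEMeasurable (subgrad X f) ν := by
  refine (PiLp.continuous_toLp 2 _).measurable.comp_aemeasurable (aemeasurable_pi_iff.2 fun i => ?_)
  obtain ⟨s, hsc, hs⟩ := TopologicalSpace.countable_cover_nhds
    (fun x : M => chart_source_mem_nhds (EuclideanSpace ℝ (Fin n)) x)
  have := hsc.to_subtype
  rw [biUnion_eq_iUnion] at hs
  rw [← Measure.restrict_univ (μ := ν), ← hs]
  exact aemeasurable_iUnion_iff.2 fun x₁ => aemeasurable_restrict_mfderiv_apply (hX i) hf x₁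

end Calculus

section LipDiff

lemma locallyLipschitz_comp {M : Type*} [PseudoEMetricSpace M] {f : M → ℝ} {Φ : ℝ → ℝ}
    (hf : LocallyLipschitz f) (hΦ : ∀ x, ContDiffAt ℝ 1 Φ (f x)) :
    LocallyLipschitz fun x => Φ (f x) := by
  intro x
  obtain ⟨K, t, ht, hK⟩ := hf x
  obtain ⟨K', t', ht', hK'⟩ := (hΦ x).exists_lipschitzOnWith
  exact ⟨K' * K, t ∩ f ⁻¹' t', inter_mem ht (hf.continuous.continuousAt ht'),
    hK'.comp (hK.mono inter_subset_left) fun y hy => hy.2⟩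

variable {n m : ℕ} {M : Type*} [MetricSpace M] [ChartedSpace (EuclideanSpace ℝ (Fin n)) M]
  [MeasurableSpace M] {ν : Measure M} {f g : M → ℝ}

/-- The locally Lipschitz functions that are differentiable `ν`-almost everywhere. When the
distance dominates the intrinsic one, all test functions are of this kind
(`IsTestFunction.lipDiff`), and unlike test functions they form an algebra. -/
def LipDiff (n : ℕ) {M : Type*} [MetricSpace M] [ChartedSpace (EuclideanSpace ℝ (Fin n)) M]
    [MeasurableSpace M] (ν : Measure M) (f : M → ℝ) : Prop :=
  LocallyLipschitz f ∧ ∀ᵐ x ∂ν, MDifferentiableAt (𝓡 n) 𝓘(ℝ, ℝ) f x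

namespace LipDiff

lemma isTestFunction (hf : LipDiff n ν f) : IsTestFunction n ν f :=
  ⟨Or.inr hf.1, hf.2⟩

lemma continuous (hf : LipDiff n ν f) : Continuous f := hf.1.continuous

lemma mono_ac {ν' : Measure M} (h : ν ≪ ν') (hf : LipDiff n ν' f) : LipDiff n ν f :=
  ⟨hf.1, h.ae_le hf.2⟩

lemma comp {Φ : ℝ → ℝ} (hf : LipDiff n ν f) (hΦ : ∀ x, ContDiffAt ℝ 1 Φ (f x)) :
    LipDiff n ν fun x => Φ (f x) :=
  ⟨locallyLipschitz_comp hf.1 hΦ, hf.2.mono fun x hx =>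
    ((hΦ x).differentiableAt one_ne_zero).mdifferentiableAt.comp x hx⟩

lemma add (hf : LipDiff n ν f) (hg : LipDiff n ν g) : LipDiff n ν fun x => f x + g x :=
  ⟨(contDiff_fst.add contDiff_snd : ContDiff ℝ 1 fun z : ℝ × ℝ => z.1 + z.2).locallyLipschitz.comp
      (hf.1.prodMk hg.1),
    hf.2.mp (hg.2.mono fun _ hgx hfx => (hfx.hasMFDerivAt.add hgx.hasMFDerivAt).mdifferentiableAt)⟩

lemma mul (hf : LipDiff n ν f) (hg : LipDiff n ν g) : LipDiff n ν fun x => f x * g x :=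
  ⟨(contDiff_fst.mul contDiff_snd : ContDiff ℝ 1 fun z : ℝ × ℝ => z.1 * z.2).locallyLipschitz.comp
      (hf.1.prodMk hg.1),
    hf.2.mp (hg.2.mono fun _ hgx hfx => (hfx.hasMFDerivAt.mul hgx.hasMFDerivAt).mdifferentiableAt)⟩

variable (X : Fin m → (x : M) → TangentSpace (𝓡 n) x)

lemma ae_subgrad_comp {Φ : ℝ → ℝ} (hf : LipDiff n ν f) (hΦ : ∀ x, ContDiffAt ℝ 1 Φ (f x)) :
    ∀ᵐ x ∂ν, subgrad X (fun y => Φ (f y)) x = deriv Φ (f x) • subgrad X f x :=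
  hf.2.mono fun x hx => subgrad_comp hx ((hΦ x).differentiableAt one_ne_zero).hasDerivAt

lemma ae_subgrad_mul (hf : LipDiff n ν f) (hg : LipDiff n ν g) :
    ∀ᵐ x ∂ν, subgrad X (fun y => f y * g y) x = f x • subgrad X g x + g x • subgrad X f x :=
  hf.2.mp (hg.2.mono fun _ hgx hfx => subgrad_mul hfx hgx)

end LipDiff

variable {X : Fin m → (x : M) → TangentSpace (𝓡 n) x} {L : ℝ≥0}

lemma IsTestFunction.const_mul (hf : IsTestFunction n ν f) (c : ℝ) :
    IsTestFunction n ν fun x => c * f x :=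
  ⟨hf.1.imp (contMDiff_const.mul ·) (locallyLipschitz_comp (Φ := (c * ·)) · fun _ => by fun_prop),
    hf.2.mono fun x hx =>
      (by fun_prop : DifferentiableAt ℝ (c * ·) (f x)).mdifferentiableAt.comp x hx⟩

lemma dist_le_of_norm_subgrad_le (hL : ∀ x y : M, intrinsicEDist X ν x y ≤ L * edist x y)
    (hf : IsTestFunction n ν f) {C : ℝ} (hC : 0 < C) (h : ∀ᵐ x ∂ν, ‖subgrad X f x‖ ≤ C) (x y : M) :
    dist (f x) (f y) ≤ C * L * dist x y := by
  have hgrad : ∀ᵐ z ∂ν, ‖subgrad X (fun x => C⁻¹ * f x) z‖ ≤ 1 := by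
    filter_upwards [hf.2, h] with z hz hz2
    rw [subgrad_comp hz (hasDerivAt_const_mul C⁻¹), norm_smul, Real.norm_of_nonneg (by positivity),
      inv_mul_le_iff₀ hC, mul_one]
    exact hz2
  have hle : edist (C⁻¹ * f x) (C⁻¹ * f y) ≤ L * edist x y :=
    (le_iSup₂_of_le (f := fun (φ : M → ℝ) (_ : IsTestFunction n ν φ) =>
      ⨆ (_ : ∀ᵐ z ∂ν, ‖subgrad X φ z‖ ≤ 1), edist (φ x) (φ y)) _ (hf.const_mul C⁻¹)
      (le_iSup_of_le hgrad le_rfl)).trans (hL x y)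
  rw [edist_dist, edist_dist, ← ENNReal.ofReal_coe_nnreal, ← ENNReal.ofReal_mul L.coe_nonneg,
    ENNReal.ofReal_le_ofReal_iff (by positivity), Real.dist_eq, ← mul_sub, abs_mul,
    abs_of_pos (inv_pos.2 hC), inv_mul_le_iff₀ hC] at hle
  rwa [Real.dist_eq, mul_assoc]

variable [IsManifold (𝓡 n) ∞ M]

-- Near `x` the function agrees with its product with a bump, whose subgradient is bounded.
lemma locallyLipschitz_of_contMDiff
    (hX : ∀ i, Continuous fun x => (⟨x, X i x⟩ : TangentBundle (𝓡 n) M))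
    (hL : ∀ x y : M, intrinsicEDist X ν x y ≤ L * edist x y)
    (hf : ContMDiff (𝓡 n) 𝓘(ℝ, ℝ) ∞ f) : LocallyLipschitz f := by
  intro x
  obtain b : SmoothBumpFunction (𝓡 n) x := Classical.choice inferInstance
  have hbf : ContMDiff (𝓡 n) 𝓘(ℝ, ℝ) ∞ fun y => b y * f y := b.contMDiff.mul hf
  have hsupp : HasCompactSupport (subgrad X fun y => b y * f y) :=
    b.hasCompactSupport.mul_right.mono' support_subgrad_subset
  obtain ⟨C, hC⟩ := hsupp.exists_bound_of_continuous (continuous_subgrad hX (hbf.of_le (by simp)))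
  have hlip := dist_le_of_norm_subgrad_le (C := |C| + 1) hL
    ⟨Or.inl hbf, Eventually.of_forall fun y => hbf.mdifferentiableAt (by simp)⟩ (by positivity)
    (Eventually.of_forall fun y => (hC y).trans (by linarith [le_abs_self C]))
  refine ⟨Real.toNNReal (|C| + 1) * L, {y | b y = 1}, b.eventuallyEq_one, ?_⟩
  refine LipschitzOnWith.of_dist_le_mul fun y (hy : b y = 1) z (hz : b z = 1) => ?_
  rw [NNReal.coe_mul, Real.coe_toNNReal _ (by positivity)]
  simpa only [hy, hz, one_mul] using hlip y z

lemma IsTestFunction.lipDiff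
    (hX : ∀ i, Continuous fun x => (⟨x, X i x⟩ : TangentBundle (𝓡 n) M))
    (hL : ∀ x y : M, intrinsicEDist X ν x y ≤ L * edist x y)
    {ν' : Measure M} (hf : IsTestFunction n ν' f) : LipDiff n ν' f :=
  ⟨hf.1.elim (locallyLipschitz_of_contMDiff hX hL) id, hf.2⟩

end LipDiff

lemma IsVolume.isLocallyFiniteMeasure {n : ℕ} {M : Type*} [TopologicalSpace M]
    [ChartedSpace (EuclideanSpace ℝ (Fin n)) M] [MeasurableSpace M] [OpensMeasurableSpace M]
    {ν : Measure M} (h : IsVolume n ν) : IsLocallyFiniteMeasure ν := by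
  refine ⟨fun x => ?_⟩
  set e := chartAt (EuclideanSpace ℝ (Fin n)) x
  obtain ⟨ρ, hρ, -, hν⟩ := h e (chart_mem_atlas _ x)
  obtain ⟨r, hr, hball⟩ := Metric.nhds_basis_closedBall.mem_iff.1
    (e.open_target.mem_nhds (e.map_source (mem_chart_source _ x)))
  obtain ⟨C, hC⟩ := (isCompact_closedBall (e x) r).exists_bound_of_continuousOn (hρ.mono hball)
  set s := e.source ∩ e ⁻¹' Metric.ball (e x) r
  have hs : IsOpen s := e.isOpen_inter_preimage Metric.isOpen_ball
  have himage : e '' s ⊆ Metric.closedBall (e x) r :=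
    (image_mono inter_subset_right).trans
      ((image_preimage_subset _ _).trans Metric.ball_subset_closedBall)
  refine ⟨s, hs.mem_nhds ⟨mem_chart_source _ x, Metric.mem_ball_self hr⟩, ?_⟩
  calc ν s = ∫⁻ y in e '' s, ENNReal.ofReal (ρ y) := hν _ hs.measurableSet inter_subset_left
    _ ≤ ∫⁻ y in Metric.closedBall (e x) r, ENNReal.ofReal (ρ y) := lintegral_mono_set himage
    _ ≤ ∫⁻ _ in Metric.closedBall (e x) r, ENNReal.ofReal C :=
        setLIntegral_mono measurable_const fun _ hy =>
          ENNReal.ofReal_le_ofReal ((le_abs_self _).trans (hC _ hy))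
    _ < ⊤ := by
        rw [setLIntegral_const]
        exact ENNReal.mul_lt_top ENNReal.ofReal_lt_top measure_closedBall_lt_top

section Lintegral

lemma le_two_mul_of_le_add_half {a b : ℝ≥0∞} (ha : a ≠ ⊤) (h : a ≤ b + a / 2) : a ≤ 2 * b := by
  have hhalf : a / 2 ≤ b := by
    rw [← ENNReal.sub_half ha]
    exact tsub_le_iff_right.2 h
  rwa [ENNReal.div_le_iff two_ne_zero ENNReal.ofNat_ne_top, mul_comm] at hhalf

lemma enorm_sq_eq_ofReal {E : Type*} [SeminormedAddGroup E] (v : E) :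
    ‖v‖ₑ ^ 2 = ENNReal.ofReal (‖v‖ ^ 2) := by
  rw [← ofReal_norm, ENNReal.ofReal_pow (norm_nonneg _)]

variable {α : Type*} [MeasurableSpace α] {μ : Measure α}

lemma lintegral_ofReal_const_mul {c : ℝ} (hc : 0 ≤ c) (f : α → ℝ) :
    ∫⁻ x, ENNReal.ofReal (c * f x) ∂μ = ENNReal.ofReal c * ∫⁻ x, ENNReal.ofReal (f x) ∂μ := by
  simp_rw [ENNReal.ofReal_mul hc]
  exact lintegral_const_mul' _ _ ENNReal.ofReal_ne_top

lemma lintegral_ofReal_mono_ae {f g : α → ℝ} (h : ∀ᵐ x ∂μ, f x ≤ g x) :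
    ∫⁻ x, ENNReal.ofReal (f x) ∂μ ≤ ∫⁻ x, ENNReal.ofReal (g x) ∂μ :=
  lintegral_mono_ae (h.mono fun _ hx => ENNReal.ofReal_le_ofReal hx)

lemma lintegral_ofReal_le_mul {f g : α → ℝ} {c : ℝ} (hc : 0 ≤ c) (h : ∀ᵐ x ∂μ, f x ≤ c * g x) :
    ∫⁻ x, ENNReal.ofReal (f x) ∂μ ≤ ENNReal.ofReal c * ∫⁻ x, ENNReal.ofReal (g x) ∂μ :=
  (lintegral_ofReal_mono_ae h).trans_eq (lintegral_ofReal_const_mul hc g)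

lemma lintegral_ofReal_le_mul_add {f g k : α → ℝ} {c b : ℝ} (hc : 0 ≤ c) (hb : 0 ≤ b)
    (hf : AEMeasurable f μ) (h : ∀ᵐ x ∂μ, k x ≤ c * f x + b * g x) :
    ∫⁻ x, ENNReal.ofReal (k x) ∂μ ≤ ENNReal.ofReal c * ∫⁻ x, ENNReal.ofReal (f x) ∂μ +
      ENNReal.ofReal b * ∫⁻ x, ENNReal.ofReal (g x) ∂μ := by
  rw [← lintegral_ofReal_const_mul hc, ← lintegral_ofReal_const_mul hb,
    ← lintegral_add_left' (hf.const_mul c).ennreal_ofReal]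
  exact lintegral_mono_ae (h.mono fun x hx =>
    (ENNReal.ofReal_le_ofReal hx).trans ENNReal.ofReal_add_le)

lemma lintegral_ofReal_le_of_tendsto {F : ℕ → α → ℝ} {f : α → ℝ} {B : ℝ≥0∞}
    (hF : ∀ j, AEMeasurable (F j) μ) (hlim : ∀ x, Tendsto (fun j => F j x) atTop (𝓝 (f x)))
    (hB : ∀ j, ∫⁻ x, ENNReal.ofReal (F j x) ∂μ ≤ B) : ∫⁻ x, ENNReal.ofReal (f x) ∂μ ≤ B := by
  simp_rw [fun x => (ENNReal.tendsto_ofReal (hlim x)).liminf_eq.symm]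
  exact (lintegral_liminf_le' fun j => (hF j).ennreal_ofReal).trans
    ((liminf_le_liminf (Eventually.of_forall hB)).trans_eq (liminf_const B))

end Lintegral

section Cutoff

lemma exists_abs_deriv_smoothTransition_le :
    ∃ S : ℝ, 0 < S ∧ ∀ t : ℝ, |deriv Real.smoothTransition t| ≤ S := by
  have hc : Continuous (deriv Real.smoothTransition) :=
    (Real.smoothTransition.contDiff (n := 1)).continuous_deriv le_rfl
  have hs : HasCompactSupport (deriv Real.smoothTransition) := by
    refine HasCompactSupport.intro (isCompact_Icc (a := (0 : ℝ)) (b := 1)) fun t ht => ?_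
    rw [mem_Icc, not_and_or, not_le, not_le] at ht
    rcases ht with ht | ht
    · have h : Real.smoothTransition =ᶠ[𝓝 t] fun _ => 0 :=
        eventually_of_mem (Iio_mem_nhds ht) fun s hs => Real.smoothTransition.zero_of_nonpos hs.le
      rw [h.deriv_eq, deriv_const]
    · have h : Real.smoothTransition =ᶠ[𝓝 t] fun _ => 1 :=
        eventually_of_mem (Ioi_mem_nhds ht) fun s hs => Real.smoothTransition.one_of_one_le hs.le
      rw [h.deriv_eq, deriv_const]
  obtain ⟨C, hC⟩ := hs.exists_bound_of_continuous hc
  exact ⟨|C| + 1, by positivity, fun t => (hC t).trans (by linarith [le_abs_self C])⟩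

/-- A smooth cutoff, equal to `1` on `(-∞, R - 1]` and to `0` on `[R, ∞)`. -/
noncomputable def cutoff (R t : ℝ) : ℝ := Real.smoothTransition (R - t)

variable {R t : ℝ}

lemma contDiff_cutoff : ContDiff ℝ 1 (cutoff R) :=
  Real.smoothTransition.contDiff.comp (contDiff_const.sub contDiff_id)

lemma cutoff_nonneg : 0 ≤ cutoff R t := Real.smoothTransition.nonneg _

lemma cutoff_le_one : cutoff R t ≤ 1 := Real.smoothTransition.le_one _

lemma abs_cutoff_le_one : |cutoff R t| ≤ 1 := (abs_of_nonneg cutoff_nonneg).trans_le cutoff_le_one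

lemma cutoff_eq_zero (h : R ≤ t) : cutoff R t = 0 :=
  Real.smoothTransition.zero_of_nonpos (sub_nonpos.2 h)

lemma cutoff_eq_one (h : t + 1 ≤ R) : cutoff R t = 1 :=
  Real.smoothTransition.one_of_one_le (by linarith)

lemma eventually_cutoff_eq_one (t : ℝ) : ∀ᶠ j : ℕ in atTop, cutoff j t = 1 :=
  (tendsto_natCast_atTop_atTop.eventually_ge_atTop (t + 1)).mono fun _ => cutoff_eq_one

lemma exists_abs_deriv_cutoff_le : ∃ S : ℝ, 0 < S ∧ ∀ R t : ℝ, |deriv (cutoff R) t| ≤ S := by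
  obtain ⟨S, hS, hb⟩ := exists_abs_deriv_smoothTransition_le
  refine ⟨S, hS, fun R t => ?_⟩
  change |deriv (fun t => Real.smoothTransition (R - t)) t| ≤ S
  rw [deriv_comp_const_sub, abs_neg]
  exact hb _

lemma hasCompactSupport_mul_cutoff_dist {M : Type*} [PseudoMetricSpace M] [ProperSpace M]
    (f : M → ℝ) (x₀ : M) (R : ℝ) : HasCompactSupport fun x => f x * cutoff R (dist x₀ x) := by
  refine HasCompactSupport.intro (isCompact_closedBall x₀ R) fun x hx => ?_
  rw [Metric.mem_closedBall', not_le] at hx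
  rw [cutoff_eq_zero hx.le, mul_zero]

lemma tsupport_mul_one_sub_cutoff_dist_subset {M : Type*} [PseudoMetricSpace M]
    (g : M → ℝ) (x₀ : M) :
    tsupport (fun x => g x * (1 - cutoff 3 (dist x₀ x))) ⊆ {x | 1 < dist x₀ x} := by
  have hclosed : IsClosed {x : M | 2 ≤ dist x₀ x} :=
    isClosed_le continuous_const (continuous_const.dist continuous_id)
  have hsupp : Function.support (fun x => g x * (1 - cutoff 3 (dist x₀ x))) ⊆
      {x | 2 ≤ dist x₀ x} := fun x hx => by
    by_contra hlt
    rw [mem_ofPred_eq, not_le] at hlt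
    exact hx (by simp [cutoff_eq_one (R := 3) (t := dist x₀ x) (by linarith)])
  exact (closure_minimal hsupp hclosed).trans fun x (hx : 2 ≤ dist x₀ x) => by
    rw [mem_ofPred_eq]
    linarith

end Cutoff

section Gibbs

variable {M : Type*} [MeasurableSpace M] {ν : Measure M} {U : M → ℝ}

/-- The (unnormalized) Gibbs measure with density `e^{-U}`. -/
noncomputable def gibbs {M : Type*} [MeasurableSpace M] (ν : Measure M) (U : M → ℝ) : Measure M :=
  ν.withDensity fun x => ENNReal.ofReal (Real.exp (-U x))

lemma gibbs_absolutelyContinuous : gibbs ν U ≪ ν := withDensity_absolutelyContinuous _ _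

lemma gibbs_restrict_le {s : Set M} (hs : MeasurableSet s) {b : ℝ} (hU : ∀ x ∈ s, -b ≤ U x) :
    (gibbs ν U).restrict s ≤ ENNReal.ofReal (Real.exp b) • ν.restrict s := by
  rw [gibbs, restrict_withDensity hs, ← withDensity_const]
  refine withDensity_mono ((ae_restrict_mem hs).mono fun x hx => ?_)
  exact ENNReal.ofReal_le_ofReal (Real.exp_le_exp.2 (by linarith [hU x hx]))

variable [TopologicalSpace M] [BorelSpace M]

lemma absolutelyContinuous_gibbs (hU : Continuous U) : ν ≪ gibbs ν U :=
  withDensity_absolutelyContinuous' (by fun_prop)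
    (Eventually.of_forall fun x => by simpa using Real.exp_pos _)

lemma isLocallyFiniteMeasure_gibbs [IsLocallyFiniteMeasure ν] (hU : Continuous U) :
    IsLocallyFiniteMeasure (gibbs ν U) :=
  IsLocallyFiniteMeasure.withDensity_ofReal (by fun_prop)

lemma lintegral_ofReal_gibbs (hU : Continuous U) (F : M → ℝ) :
    ∫⁻ x, ENNReal.ofReal (F x) ∂(gibbs ν U) =
      ∫⁻ x, ENNReal.ofReal (Real.exp (-U x) * F x) ∂ν := by
  rw [gibbs, lintegral_withDensity_eq_lintegral_mul_non_measurable _ (by fun_prop)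
    (Eventually.of_forall fun x => ENNReal.ofReal_lt_top)]
  simp_rw [ENNReal.ofReal_mul (Real.exp_nonneg _)]
  rfl

lemma integrable_gibbs_iff (hU : Continuous U) {F : M → ℝ} :
    Integrable F (gibbs ν U) ↔ Integrable (fun x => Real.exp (-U x) * F x) ν := by
  rw [gibbs, integrable_withDensity_iff_integrable_smul' (by fun_prop)
    (Eventually.of_forall fun x => ENNReal.ofReal_lt_top)]
  simp_rw [ENNReal.toReal_ofReal (Real.exp_nonneg _), smul_eq_mul]

lemma integral_gibbs (hU : Continuous U) (F : M → ℝ) :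
    ∫ x, F x ∂(gibbs ν U) = ∫ x, Real.exp (-U x) * F x ∂ν := by
  rw [gibbs, integral_withDensity_eq_integral_toReal_smul (by fun_prop)
    (Eventually.of_forall fun x => ENNReal.ofReal_lt_top)]
  simp_rw [ENNReal.toReal_ofReal (Real.exp_nonneg _), smul_eq_mul]

lemma restrict_le_gibbs {s : Set M} (hs : MeasurableSet s) {b : ℝ} (hUc : Continuous U)
    (hU : ∀ x ∈ s, U x ≤ b) :
    ν.restrict s ≤ ENNReal.ofReal (Real.exp b) • (gibbs ν U).restrict s := by
  rw [gibbs, restrict_withDensity hs, ← withDensity_smul _ (by fun_prop)]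
  conv_lhs => rw [← withDensity_one (μ := ν.restrict s)]
  refine withDensity_mono ((ae_restrict_mem hs).mono fun x hx => ?_)
  rw [Pi.smul_apply, smul_eq_mul, ← ENNReal.ofReal_mul (Real.exp_nonneg _), ← Real.exp_add]
  exact ENNReal.one_le_ofReal.2 (Real.one_le_exp (by linarith [hU x hx]))

end Gibbs

section Confinement

variable {n m : ℕ} {M : Type*} [MetricSpace M] [ChartedSpace (EuclideanSpace ℝ (Fin n)) M]
  [MeasurableSpace M] {ν : Measure M} {X : Fin m → (x : M) → TangentSpace (𝓡 n) x}
  {x₀ : M} {U f u ψ φ : M → ℝ} {r : ℝ}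

lemma LipDiff.ae_norm_subgrad_mul_comp_le (hf : LipDiff n ν f) (hu : LipDiff n ν u)
    (hu1 : ∀ᵐ x ∂ν, ‖subgrad X u x‖ ≤ 1) {Φ : ℝ → ℝ} (hΦ : ContDiff ℝ 1 Φ) {S : ℝ}
    (hΦ1 : ∀ t, |Φ t| ≤ 1) (hΦ' : ∀ t, |deriv Φ t| ≤ S) :
    ∀ᵐ x ∂ν, ‖subgrad X (fun y => f y * Φ (u y)) x‖ ≤ S * |f x| + ‖subgrad X f x‖ := by
  have hΦat : ∀ x, ContDiffAt ℝ 1 Φ (u x) := fun _ => hΦ.contDiffAt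
  filter_upwards [hf.ae_subgrad_mul X (hu.comp hΦat), hu.ae_subgrad_comp X hΦat, hu1]
    with x hmul hcomp hx
  rw [hmul, hcomp]
  calc ‖f x • deriv Φ (u x) • subgrad X u x + Φ (u x) • subgrad X f x‖
      ≤ |f x| * (|deriv Φ (u x)| * ‖subgrad X u x‖) + |Φ (u x)| * ‖subgrad X f x‖ := by
        simpa only [norm_smul, Real.norm_eq_abs] using norm_add_le (f x • deriv Φ (u x) •
          subgrad X u x) (Φ (u x) • subgrad X f x)
    _ ≤ |f x| * (S * 1) + 1 * ‖subgrad X f x‖ := by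
        have hS : 0 ≤ S := (abs_nonneg _).trans (hΦ' 0)
        gcongr
        exacts [hΦ' _, hΦ1 _]
    _ = S * |f x| + ‖subgrad X f x‖ := by ring

lemma LipDiff.mul_exp_neg (hψ : LipDiff n ν ψ) (hU : LipDiff n ν U) :
    LipDiff n ν fun x => ψ x * Real.exp (-U x) :=
  hψ.mul (hU.comp (Φ := fun t => Real.exp (-t)) fun _ => by fun_prop)

lemma LipDiff.ae_subgrad_mul_exp_neg (hψ : LipDiff n ν ψ) (hU : LipDiff n ν U) :
    ∀ᵐ x ∂ν, subgrad X (fun y => ψ y * Real.exp (-U y)) x =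
      Real.exp (-U x) • (subgrad X ψ x - ψ x • subgrad X U x) := by
  have hexp : ∀ x, ContDiffAt ℝ 1 (fun t => Real.exp (-t)) (U x) := fun _ => by fun_prop
  have hderiv : ∀ t : ℝ, deriv (fun t => Real.exp (-t)) t = -Real.exp (-t) := fun t => by
    simpa using (hasDerivAt_neg t).exp.deriv
  filter_upwards [hψ.ae_subgrad_mul X (hU.comp hexp), hU.ae_subgrad_comp X hexp] with x hmul hcomp
  rw [hmul, hcomp, hderiv]
  module

lemma LaplacianLEOn.integral_mul_inner_le [BorelSpace M] {A : Set M} {K : ℝ}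
    (hlap : LaplacianLEOn X ν u A K) (hu1 : ∀ᵐ x ∂ν, ‖subgrad X u x‖ ≤ 1)
    (hum : AEMeasurable (subgrad X u) ν) (hU : LipDiff n ν U) (hψ : LipDiff n ν ψ)
    (hψc : HasCompactSupport ψ) (hψA : tsupport ψ ⊆ A) (hψ0 : ∀ x, 0 ≤ ψ x)
    (hψm : AEMeasurable (subgrad X ψ) ν)
    (hψi : Integrable (fun x => ‖subgrad X ψ x‖) (gibbs ν U))
    (hUi : Integrable (fun x => ψ x * inner ℝ (subgrad X u x) (subgrad X U x)) (gibbs ν U)) :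
    ∫ x, ψ x * inner ℝ (subgrad X u x) (subgrad X U x) ∂(gibbs ν U) ≤
      K * ∫ x, ψ x ∂(gibbs ν U) + ∫ x, ‖subgrad X ψ x‖ ∂(gibbs ν U) := by
  have hgrad : ∀ᵐ x ∂ν, inner ℝ (subgrad X u x) (subgrad X (fun y => ψ y * Real.exp (-U y)) x) =
      Real.exp (-U x) * (inner ℝ (subgrad X u x) (subgrad X ψ x) -
        ψ x * inner ℝ (subgrad X u x) (subgrad X U x)) := by
    filter_upwards [hψ.ae_subgrad_mul_exp_neg hU] with x hx
    rw [hx, inner_smul_right, inner_sub_right, inner_smul_right]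
  have hle : ∀ᵐ x ∂(gibbs ν U), |inner ℝ (subgrad X u x) (subgrad X ψ x)| ≤ ‖subgrad X ψ x‖ := by
    filter_upwards [gibbs_absolutelyContinuous hu1] with x hx
    exact (abs_real_inner_le_norm _ _).trans (mul_le_of_le_one_left (norm_nonneg _) hx)
  have hi : Integrable (fun x => inner ℝ (subgrad X u x) (subgrad X ψ x)) (gibbs ν U) :=
    hψi.mono' ((hum.inner hψm).mono_ac gibbs_absolutelyContinuous).aestronglyMeasurable hle
  have hweak := hlap _ (hψ.mul_exp_neg hU).isTestFunction hψc.mul_right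
    ((tsupport_mul_subset_left (f := ψ)).trans hψA)
    (fun x => mul_nonneg (hψ0 x) (Real.exp_nonneg _))
    (((integrable_gibbs_iff hU.continuous).1 (hi.sub hUi)).congr (hgrad.mono fun _ hx => hx.symm))
  simp_rw [mul_comm (ψ _)] at hweak
  simp_rw [mul_comm (ψ _) (Real.exp _)] at hgrad
  rw [integral_congr_ae hgrad, ← integral_gibbs hU.continuous, ← integral_gibbs hU.continuous,
    integral_sub hi hUi] at hweak
  have hψle := integral_mono_ae hi hψi (hle.mono fun x hx => (le_abs_self _).trans hx)
  linarith

/-- A potential `U` whose gradient is comparable with `d ^ r` in the radial direction, on a space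
where the distance `d` from `x₀` has a Laplacian bounded above. -/
structure Confining (X : Fin m → (x : M) → TangentSpace (𝓡 n) x) (ν : Measure M) (x₀ : M)
    (U : M → ℝ) (r : ℝ) : Prop where
  aemeasurable_subgrad : ∀ f : M → ℝ, LipDiff n ν f → AEMeasurable (subgrad X f) ν
  pos : 0 < r
  le_one : r ≤ 1
  lipDiff_dist : LipDiff n ν fun y => dist x₀ y
  norm_subgrad_dist_le : ∀ᵐ x ∂ν, ‖subgrad X (fun y => dist x₀ y) x‖ ≤ 1
  laplacian_dist_le : ∃ K : ℝ, 0 < K ∧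
    LaplacianLEOn X ν (fun y => dist x₀ y) {x | 1 < dist x₀ x} K
  lipDiff : LipDiff n ν U
  drift : ∃ c γ : ℝ, 0 < c ∧ 0 < γ ∧ ∀ᵐ x ∂ν,
    c * dist x₀ x ^ r - γ ≤ inner ℝ (subgrad X (fun y => dist x₀ y) x) (subgrad X U x)
  norm_subgrad_le : ∃ A : ℝ, 0 < A ∧ ∀ᵐ x ∂ν, ‖subgrad X U x‖ ≤ A * (1 + dist x₀ x ^ r)
  potential_le : ∃ A : ℝ, 0 < A ∧ ∀ x, U x ≤ A * (1 + dist x₀ x ^ (r + 1))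

namespace Confining

lemma continuous_dist_rpow (h : Confining X ν x₀ U r) : Continuous fun x : M => dist x₀ x ^ r :=
  (continuous_const.dist continuous_id).rpow_const fun _ => Or.inr h.pos.le

lemma aemeasurable_subgrad_gibbs (h : Confining X ν x₀ U r) (hf : LipDiff n ν f) :
    AEMeasurable (subgrad X f) (gibbs ν U) :=
  (h.aemeasurable_subgrad f hf).mono_ac gibbs_absolutelyContinuous

lemma lintegral_norm_subgrad_mul_comp_dist_add_le (h : Confining X ν x₀ U r)
    (hψ : LipDiff n ν ψ) (hψ0 : ∀ x, 0 ≤ ψ x) {Φ : ℝ → ℝ} (hΦ : ContDiff ℝ 1 Φ)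
    (hΦ0 : ∀ t, 0 ≤ Φ t) (hΦ1 : ∀ t, Φ t ≤ 1) {S : ℝ} (hS : ∀ t, |deriv Φ t| ≤ S) :
    ∫⁻ x, ENNReal.ofReal (‖subgrad X (fun y => ψ y * Φ (dist x₀ y)) x‖ + ψ x * Φ (dist x₀ x))
        ∂(gibbs ν U) ≤
      ENNReal.ofReal (S + 1) * ∫⁻ x, ENNReal.ofReal (‖subgrad X ψ x‖ + ψ x) ∂(gibbs ν U) := by
  have hS0 : 0 ≤ S := (abs_nonneg _).trans (hS 0)
  refine lintegral_ofReal_le_mul (by positivity) ?_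
  filter_upwards [gibbs_absolutelyContinuous (hψ.ae_norm_subgrad_mul_comp_le h.lipDiff_dist
    h.norm_subgrad_dist_le hΦ (fun t => (abs_of_nonneg (hΦ0 t)).trans_le (hΦ1 t)) hS)] with x hx
  rw [abs_of_nonneg (hψ0 x)] at hx
  have hle : ψ x * Φ (dist x₀ x) ≤ ψ x := mul_le_of_le_one_right (hψ0 x) (hΦ1 _)
  have hslack : 0 ≤ S * ‖subgrad X ψ x‖ := by positivity
  linarith

variable [BorelSpace M] [IsLocallyFiniteMeasure ν]

lemma integrable_mul_inner_of_hasCompactSupport (h : Confining X ν x₀ U r) (hψ : Continuous ψ)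
    (hψc : HasCompactSupport ψ) :
    Integrable (fun x => ψ x * inner ℝ (subgrad X (fun y => dist x₀ y) x) (subgrad X U x))
      (gibbs ν U) := by
  have := isLocallyFiniteMeasure_gibbs (ν := ν) h.lipDiff.continuous
  have hdr := h.continuous_dist_rpow
  obtain ⟨A, -, hgrowth⟩ := h.norm_subgrad_le
  have hdom : Integrable (fun x => |ψ x| * (A * (1 + dist x₀ x ^ r))) (gibbs ν U) :=
    Continuous.integrable_of_hasCompactSupport (by fun_prop) hψc.norm.mul_right
  have hmeas := (h.aemeasurable_subgrad_gibbs h.lipDiff_dist).inner (𝕜 := ℝ)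
    (h.aemeasurable_subgrad_gibbs h.lipDiff)
  refine hdom.mono' (hψ.aemeasurable.mul hmeas).aestronglyMeasurable ?_
  filter_upwards [gibbs_absolutelyContinuous hgrowth,
    gibbs_absolutelyContinuous h.norm_subgrad_dist_le] with x hx hdx
  rw [norm_mul, Real.norm_eq_abs]
  gcongr
  exact (norm_inner_le_norm _ _).trans ((mul_le_of_le_one_left (norm_nonneg _) hdx).trans hx)

lemma integral_mul_dist_rpow_le_of_hasCompactSupport (h : Confining X ν x₀ U r) :
    ∃ C : ℝ, 0 < C ∧ ∀ ψ : M → ℝ, LipDiff n ν ψ → HasCompactSupport ψ →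
      tsupport ψ ⊆ {x | 1 < dist x₀ x} → (∀ x, 0 ≤ ψ x) →
        Integrable (fun x => ‖subgrad X ψ x‖) (gibbs ν U) →
          ∫ x, ψ x * dist x₀ x ^ r ∂(gibbs ν U) ≤
            C * ∫ x, (‖subgrad X ψ x‖ + ψ x) ∂(gibbs ν U) := by
  obtain ⟨c, γ, hc, hγ, hdrift⟩ := h.drift
  obtain ⟨K, hK, hlap⟩ := h.laplacian_dist_le
  refine ⟨c⁻¹ * (K + γ + 1), by positivity, fun ψ hψ hψc hψs hψ0 hgi => ?_⟩
  have := isLocallyFiniteMeasure_gibbs (ν := ν) h.lipDiff.continuous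
  have hψi : Integrable ψ (gibbs ν U) := hψ.continuous.integrable_of_hasCompactSupport hψc
  have hψd : Integrable (fun x => ψ x * dist x₀ x ^ r) (gibbs ν U) :=
    (hψ.continuous.mul h.continuous_dist_rpow).integrable_of_hasCompactSupport hψc.mul_right
  have hinner := h.integrable_mul_inner_of_hasCompactSupport hψ.continuous hψc
  have hupper := hlap.integral_mul_inner_le h.norm_subgrad_dist_le
    (h.aemeasurable_subgrad _ h.lipDiff_dist) h.lipDiff hψ hψc hψs hψ0
    (h.aemeasurable_subgrad ψ hψ) hgi hinner
  have hlower : c * ∫ x, ψ x * dist x₀ x ^ r ∂(gibbs ν U) - γ * ∫ x, ψ x ∂(gibbs ν U) ≤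
      ∫ x, ψ x * inner ℝ (subgrad X (fun y => dist x₀ y) x) (subgrad X U x) ∂(gibbs ν U) := by
    rw [← integral_const_mul, ← integral_const_mul, ← integral_sub (hψd.const_mul c)
      (hψi.const_mul γ)]
    refine integral_mono_ae ((hψd.const_mul c).sub (hψi.const_mul γ)) hinner ?_
    filter_upwards [gibbs_absolutelyContinuous hdrift] with x hx
    calc c * (ψ x * dist x₀ x ^ r) - γ * ψ x = ψ x * (c * dist x₀ x ^ r - γ) := by ring
      _ ≤ _ := mul_le_mul_of_nonneg_left hx (hψ0 x)
  rw [mul_assoc, inv_mul_eq_div, le_div_iff₀' hc, integral_add hgi hψi]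
  have hψint0 : 0 ≤ ∫ x, ψ x ∂(gibbs ν U) := integral_nonneg hψ0
  have hslack : 0 ≤ (K + γ) * ∫ x, ‖subgrad X ψ x‖ ∂(gibbs ν U) := by positivity
  linarith

lemma lintegral_mul_dist_rpow_le_of_hasCompactSupport (h : Confining X ν x₀ U r) :
    ∃ C : ℝ, 0 < C ∧ ∀ ψ : M → ℝ, LipDiff n ν ψ → HasCompactSupport ψ →
      tsupport ψ ⊆ {x | 1 < dist x₀ x} → (∀ x, 0 ≤ ψ x) →
        ∫⁻ x, ENNReal.ofReal (ψ x * dist x₀ x ^ r) ∂(gibbs ν U) ≤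
          ENNReal.ofReal C * ∫⁻ x, ENNReal.ofReal (‖subgrad X ψ x‖ + ψ x) ∂(gibbs ν U) := by
  obtain ⟨C, hC, hbound⟩ := h.integral_mul_dist_rpow_le_of_hasCompactSupport
  refine ⟨C, hC, fun ψ hψ hψc hψs hψ0 => ?_⟩
  have := isLocallyFiniteMeasure_gibbs (ν := ν) h.lipDiff.continuous
  by_cases htop : ∫⁻ x, ENNReal.ofReal (‖subgrad X ψ x‖ + ψ x) ∂(gibbs ν U) = ⊤
  · rw [htop, ENNReal.mul_top (ENNReal.ofReal_pos.2 hC).ne']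
    exact le_top
  have hsum0 : ∀ x, 0 ≤ ‖subgrad X ψ x‖ + ψ x := fun x => add_nonneg (norm_nonneg _) (hψ0 x)
  have hsum : Integrable (fun x => ‖subgrad X ψ x‖ + ψ x) (gibbs ν U) :=
    (lintegral_ofReal_ne_top_iff_integrable ((h.aemeasurable_subgrad_gibbs hψ).norm.add
      hψ.continuous.aemeasurable).aestronglyMeasurable (Eventually.of_forall hsum0)).1 htop
  have hψi : Integrable ψ (gibbs ν U) := hψ.continuous.integrable_of_hasCompactSupport hψc
  have hψd : Integrable (fun x => ψ x * dist x₀ x ^ r) (gibbs ν U) :=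
    (hψ.continuous.mul h.continuous_dist_rpow).integrable_of_hasCompactSupport hψc.mul_right
  have hgi : Integrable (fun x => ‖subgrad X ψ x‖) (gibbs ν U) :=
    (hsum.sub hψi).congr (Eventually.of_forall fun x => add_sub_cancel_right _ _)
  rw [← ofReal_integral_eq_lintegral_ofReal hψd (Eventually.of_forall fun x =>
      mul_nonneg (hψ0 x) (by positivity)), ← ofReal_integral_eq_lintegral_ofReal hsum
      (Eventually.of_forall hsum0), ← ENNReal.ofReal_mul hC.le]
  exact ENNReal.ofReal_le_ofReal (hbound ψ hψ hψc hψs hψ0 hgi)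

lemma lintegral_mul_dist_rpow_le_of_tsupport_subset [ProperSpace M] (h : Confining X ν x₀ U r) :
    ∃ C : ℝ, 0 < C ∧ ∀ ψ : M → ℝ, LipDiff n ν ψ → tsupport ψ ⊆ {x | 1 < dist x₀ x} →
      (∀ x, 0 ≤ ψ x) → ∫⁻ x, ENNReal.ofReal (ψ x * dist x₀ x ^ r) ∂(gibbs ν U) ≤
        ENNReal.ofReal C * ∫⁻ x, ENNReal.ofReal (‖subgrad X ψ x‖ + ψ x) ∂(gibbs ν U) := by
  obtain ⟨C, hC, hbound⟩ := h.lintegral_mul_dist_rpow_le_of_hasCompactSupport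
  obtain ⟨S, hS, hS'⟩ := exists_abs_deriv_cutoff_le
  refine ⟨C * (S + 1), by positivity, fun ψ hψ hψs hψ0 => ?_⟩
  have hcut (j : ℕ) : LipDiff n ν fun x => ψ x * cutoff j (dist x₀ x) :=
    hψ.mul (h.lipDiff_dist.comp fun _ => contDiff_cutoff.contDiffAt)
  refine lintegral_ofReal_le_of_tendsto (F := fun (j : ℕ) x =>
    ψ x * cutoff j (dist x₀ x) * dist x₀ x ^ r)
    (fun j => ((hcut j).continuous.mul h.continuous_dist_rpow).aemeasurable)
    (fun x => tendsto_nhds_of_eventually_eq ?_) fun j => ?_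
  · filter_upwards [eventually_cutoff_eq_one (dist x₀ x)] with j hj
    rw [hj, mul_one]
  refine (hbound _ (hcut j) (hasCompactSupport_mul_cutoff_dist ψ x₀ j)
    ((tsupport_mul_subset_left (f := ψ)).trans hψs)
    fun x => mul_nonneg (hψ0 x) cutoff_nonneg).trans ?_
  rw [ENNReal.ofReal_mul hC.le, mul_assoc]
  gcongr
  exact h.lintegral_norm_subgrad_mul_comp_dist_add_le hψ hψ0 contDiff_cutoff
    (fun _ => cutoff_nonneg) (fun _ => cutoff_le_one) (hS' j)

-- Split `g` at distance about `2`: near `x₀` the weight `d ^ r` is bounded, and the far part is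
-- supported where the Laplacian bound holds.
lemma lintegral_mul_dist_rpow_le [ProperSpace M] (h : Confining X ν x₀ U r) :
    ∃ C : ℝ, 0 < C ∧ ∀ g : M → ℝ, LipDiff n ν g → (∀ x, 0 ≤ g x) →
      ∫⁻ x, ENNReal.ofReal (g x * dist x₀ x ^ r) ∂(gibbs ν U) ≤
        ENNReal.ofReal C * ∫⁻ x, ENNReal.ofReal (‖subgrad X g x‖ + g x) ∂(gibbs ν U) := by
  obtain ⟨C, hC, hbound⟩ := h.lintegral_mul_dist_rpow_le_of_tsupport_subset
  obtain ⟨S, hS, hS'⟩ := exists_abs_deriv_cutoff_le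
  refine ⟨C * (S + 1) + 3 ^ r, by positivity, fun g hg hg0 => ?_⟩
  set χ : ℝ → ℝ := fun t => 1 - cutoff 3 t
  have hχ : ContDiff ℝ 1 χ := contDiff_const.sub contDiff_cutoff
  have hχ0 : ∀ t, 0 ≤ χ t := fun t => sub_nonneg.2 cutoff_le_one
  have hχ1 : ∀ t, χ t ≤ 1 := fun t => sub_le_self 1 cutoff_nonneg
  have hχ' : ∀ t, |deriv χ t| ≤ S := fun t => by
    rw [deriv_const_sub, abs_neg]
    exact hS' 3 t
  have hψ : LipDiff n ν fun x => g x * χ (dist x₀ x) :=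
    hg.mul (h.lipDiff_dist.comp fun _ => hχ.contDiffAt)
  have hnear : ∀ x, g x * dist x₀ x ^ r ≤
      1 * (g x * χ (dist x₀ x) * dist x₀ x ^ r) + 3 ^ r * (‖subgrad X g x‖ + g x) := fun x => by
    have hrest : 0 ≤ (3 : ℝ) ^ r * ‖subgrad X g x‖ := by positivity
    have hψ0 : 0 ≤ g x * χ (dist x₀ x) * dist x₀ x ^ r := by
      have := hg0 x
      have := hχ0 (dist x₀ x)
      positivity
    have hg3 : 0 ≤ (3 : ℝ) ^ r * g x := mul_nonneg (by positivity) (hg0 x)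
    rcases le_total (dist x₀ x) 3 with h3 | h3
    · have := mul_le_mul_of_nonneg_left (Real.rpow_le_rpow dist_nonneg h3 h.pos.le) (hg0 x)
      linarith
    · have : χ (dist x₀ x) = 1 := by simp [χ, cutoff_eq_zero h3]
      rw [this] at hψ0 ⊢
      linarith
  refine (lintegral_ofReal_le_mul_add zero_le_one (by positivity)
    (hψ.continuous.mul h.continuous_dist_rpow).aemeasurable (Eventually.of_forall hnear)).trans ?_
  rw [ENNReal.ofReal_one, one_mul, ENNReal.ofReal_add (by positivity) (by positivity), add_mul,
    ENNReal.ofReal_mul hC.le, mul_assoc]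
  gcongr
  refine (hbound _ hψ (tsupport_mul_one_sub_cutoff_dist_subset g x₀)
    fun x => mul_nonneg (hg0 x) (hχ0 _)).trans ?_
  gcongr
  exact h.lintegral_norm_subgrad_mul_comp_dist_add_le hg hg0 hχ hχ0 hχ1 hχ'

end Confining

lemma LipDiff.ae_norm_subgrad_sq_le (hf : LipDiff n ν f) :
    ∀ᵐ x ∂ν, ‖subgrad X (fun y => f y ^ 2) x‖ ≤ ‖subgrad X f x‖ ^ 2 + f x ^ 2 := by
  filter_upwards [hf.ae_subgrad_comp X (Φ := fun t => t ^ 2) fun _ => by fun_prop] with x hx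
  rw [hx, norm_smul, Real.norm_eq_abs, deriv_pow_field, ← sq_abs (f x), Nat.cast_ofNat, pow_one,
    abs_mul, abs_two]
  linarith [two_mul_le_add_sq ‖subgrad X f x‖ |f x|]

lemma LipDiff.sub_const (hf : LipDiff n ν f) (k : ℝ) : LipDiff n ν fun x => f x - k :=
  hf.comp (Φ := fun t => t - k) fun _ => by fun_prop

lemma LipDiff.ae_subgrad_sub_const (hf : LipDiff n ν f) (k : ℝ) :
    ∀ᵐ x ∂ν, subgrad X (fun y => f y - k) x = subgrad X f x := by
  filter_upwards [hf.ae_subgrad_comp X (Φ := fun t => t - k) fun _ => by fun_prop] with x hx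
  rw [hx, deriv_sub_const, deriv_id'', one_smul]

section Sobolev

variable [BorelSpace M] {ε α β : ℝ}

lemma ClassicalSobolev.lintegral_rpow_le (hS : ClassicalSobolev X ν ε α β) (hε : 0 < ε)
    (hα : 0 ≤ α) (hβ : 0 ≤ β) (hφ : LipDiff n ν φ) (hφc : HasCompactSupport φ) :
    ∫⁻ x, ENNReal.ofReal (|φ x| ^ (2 + ε)) ∂ν ≤
      (∫⁻ x, ENNReal.ofReal (α * ‖subgrad X φ x‖ ^ 2 + β * φ x ^ 2) ∂ν) ^ ((2 + ε) / 2) := by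
  have hcont := hφ.continuous
  have hsum : ENNReal.ofReal α * ∫⁻ x, ‖subgrad X φ x‖ₑ ^ 2 ∂ν +
      ENNReal.ofReal β * ∫⁻ x, ‖φ x‖ₑ ^ 2 ∂ν =
      ∫⁻ x, ENNReal.ofReal (α * ‖subgrad X φ x‖ ^ 2 + β * φ x ^ 2) ∂ν := by
    simp_rw [enorm_sq_eq_ofReal, Real.norm_eq_abs, sq_abs]
    rw [← lintegral_ofReal_const_mul hα, ← lintegral_ofReal_const_mul hβ,
      ← lintegral_add_right' _ (by fun_prop)]
    exact lintegral_congr fun x => (ENNReal.ofReal_add (by positivity) (by positivity)).symm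
  have hpow : ∫⁻ x, ‖φ x‖ₑ ^ (2 + ε) ∂ν = ∫⁻ x, ENNReal.ofReal (|φ x| ^ (2 + ε)) ∂ν :=
    lintegral_congr fun x => by
      rw [← ofReal_norm, ENNReal.ofReal_rpow_of_nonneg (norm_nonneg _) (by positivity),
        Real.norm_eq_abs]
  have hmain := ENNReal.rpow_le_rpow (hS φ hφ.isTestFunction hφc)
    (by positivity : 0 ≤ (2 + ε) / 2)
  rwa [hsum, hpow, ← ENNReal.rpow_mul, div_mul_div_cancel₀ (by positivity), div_self two_ne_zero,
    ENNReal.rpow_one] at hmain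

lemma ClassicalSobolev.exists_lintegral_rpow_le [ProperSpace M] (hS : ClassicalSobolev X ν ε α β)
    (hε : 0 < ε) (hα : 0 < α) (hβ : 0 ≤ β) (hd : LipDiff n ν fun y => dist x₀ y)
    (hd1 : ∀ᵐ x ∂ν, ‖subgrad X (fun y => dist x₀ y) x‖ ≤ 1) :
    ∃ A : ℝ, 0 < A ∧ ∀ φ : M → ℝ, LipDiff n ν φ →
      ∫⁻ x, ENNReal.ofReal (|φ x| ^ (2 + ε)) ∂ν ≤
        (ENNReal.ofReal A * ∫⁻ x, ENNReal.ofReal (‖subgrad X φ x‖ ^ 2 + φ x ^ 2) ∂ν) ^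
          ((2 + ε) / 2) := by
  obtain ⟨T, hT, hT'⟩ := exists_abs_deriv_cutoff_le
  refine ⟨2 * α + 2 * α * T ^ 2 + β, by positivity, fun φ hφ => ?_⟩
  have hcut (j : ℕ) : LipDiff n ν fun x => φ x * cutoff j (dist x₀ x) :=
    hφ.mul (hd.comp fun _ => contDiff_cutoff.contDiffAt)
  refine lintegral_ofReal_le_of_tendsto
    (F := fun (j : ℕ) x => |φ x * cutoff j (dist x₀ x)| ^ (2 + ε))
    (fun j => ((hcut j).continuous.abs.rpow_const fun _ => Or.inr (by positivity)).aemeasurable)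
    (fun x => tendsto_nhds_of_eventually_eq ?_) fun j => ?_
  · filter_upwards [eventually_cutoff_eq_one (dist x₀ x)] with j hj
    rw [hj, mul_one]
  refine (hS.lintegral_rpow_le hε hα.le hβ (hcut j)
    (hasCompactSupport_mul_cutoff_dist φ x₀ j)).trans ?_
  gcongr
  refine lintegral_ofReal_le_mul (by positivity) ?_
  filter_upwards [hφ.ae_norm_subgrad_mul_comp_le hd hd1 contDiff_cutoff
    (fun _ => abs_cutoff_le_one) (hT' j)] with x hx
  have hgrad : ‖subgrad X (fun x => φ x * cutoff j (dist x₀ x)) x‖ ^ 2 ≤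
      2 * (T ^ 2 * φ x ^ 2 + ‖subgrad X φ x‖ ^ 2) := by
    rw [← sq_abs (φ x), ← mul_pow]
    exact (pow_le_pow_left₀ (norm_nonneg _) hx 2).trans add_sq_le
  have hval : (φ x * cutoff j (dist x₀ x)) ^ 2 ≤ φ x ^ 2 := by
    rw [mul_pow]
    exact mul_le_of_le_one_right (sq_nonneg _) (pow_le_one₀ cutoff_nonneg cutoff_le_one)
  calc α * ‖subgrad X (fun x => φ x * cutoff j (dist x₀ x)) x‖ ^ 2 +
        β * (φ x * cutoff j (dist x₀ x)) ^ 2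
      ≤ α * (2 * (T ^ 2 * φ x ^ 2 + ‖subgrad X φ x‖ ^ 2)) + β * φ x ^ 2 := by gcongr
    _ ≤ (2 * α + 2 * α * T ^ 2 + β) * (‖subgrad X φ x‖ ^ 2 + φ x ^ 2) := by
      have hslack : 0 ≤ (2 * α * T ^ 2 + β) * ‖subgrad X φ x‖ ^ 2 + 2 * α * φ x ^ 2 := by
        positivity
      linarith

end Sobolev

section Poincare

variable [BorelSpace M] [ProperSpace M] [IsLocallyFiniteMeasure ν]

lemma LocalPoincare.exists_setLIntegral_sub_sq_le (hP : LocalPoincare X ν x₀) {R : ℝ}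
    (hR : 0 < R) :
    ∃ c : ℝ, 0 < c ∧ ∀ v : M → ℝ, LipDiff n ν v → ∃ k : ℝ,
      ∫⁻ x in Metric.ball x₀ R, ENNReal.ofReal ((v x - k) ^ 2) ∂ν ≤
        ENNReal.ofReal c * ∫⁻ x in Metric.ball x₀ R, ENNReal.ofReal (‖subgrad X v x‖ ^ 2) ∂ν := by
  obtain ⟨c, hc, hP⟩ := hP R hR
  refine ⟨c, hc, fun v hv => ⟨⨍ y in Metric.ball x₀ R, v y ∂ν, ?_⟩⟩
  have hle := hP v hv.isTestFunction
  simp_rw [enorm_sq_eq_ofReal, Real.norm_eq_abs, sq_abs] at hle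
  have hfin : ν (Metric.ball x₀ R) ≠ ⊤ := Metric.isBounded_ball.measure_lt_top.ne
  by_cases h0 : ν (Metric.ball x₀ R) = 0
  · simp [Measure.restrict_eq_zero.2 h0]
  · rwa [setLAverage_eq, setLAverage_eq, ← mul_div_assoc, ENNReal.div_le_iff h0 hfin,
      ENNReal.div_mul_cancel h0 hfin] at hle

lemma LocalPoincare.exists_setLIntegral_gibbs_sub_sq_le (hP : LocalPoincare X ν x₀)
    (hU : Continuous U) {R : ℝ} (hR : 0 < R) :
    ∃ c : ℝ, 0 < c ∧ ∀ v : M → ℝ, LipDiff n ν v → ∃ k : ℝ,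
      ∫⁻ x in Metric.ball x₀ R, ENNReal.ofReal ((v x - k) ^ 2) ∂(gibbs ν U) ≤
        ENNReal.ofReal c *
          ∫⁻ x in Metric.ball x₀ R, ENNReal.ofReal (‖subgrad X v x‖ ^ 2) ∂(gibbs ν U) := by
  obtain ⟨c, hc, hloc⟩ := hP.exists_setLIntegral_sub_sq_le hR
  obtain ⟨b, hb⟩ := (isCompact_closedBall x₀ R).exists_bound_of_continuousOn hU.continuousOn
  have hUb : ∀ x ∈ Metric.ball x₀ R, |U x| ≤ b := fun x hx =>
    hb x (Metric.ball_subset_closedBall hx)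
  refine ⟨Real.exp b * (c * Real.exp b), by positivity, fun v hv => ?_⟩
  obtain ⟨k, hk⟩ := hloc v hv
  refine ⟨k, ?_⟩
  rw [ENNReal.ofReal_mul (Real.exp_nonneg _), ENNReal.ofReal_mul hc.le, mul_assoc, mul_assoc]
  calc ∫⁻ x in Metric.ball x₀ R, ENNReal.ofReal ((v x - k) ^ 2) ∂(gibbs ν U)
      ≤ ENNReal.ofReal (Real.exp b) *
          ∫⁻ x in Metric.ball x₀ R, ENNReal.ofReal ((v x - k) ^ 2) ∂ν := by
        rw [← smul_eq_mul, ← lintegral_smul_measure]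
        exact lintegral_mono' (gibbs_restrict_le measurableSet_ball fun x hx =>
          (abs_le.1 (hUb x hx)).1) le_rfl
    _ ≤ _ := by
        gcongr
        refine hk.trans ?_
        gcongr
        rw [← smul_eq_mul, ← lintegral_smul_measure]
        exact lintegral_mono' (restrict_le_gibbs measurableSet_ball hU fun x hx =>
          (abs_le.1 (hUb x hx)).2) le_rfl

namespace Confining

lemma lintegral_sq_mul_dist_rpow_le (h : Confining X ν x₀ U r) :
    ∃ C : ℝ, 0 < C ∧ ∀ w : M → ℝ, LipDiff n ν w →
      ∫⁻ x, ENNReal.ofReal (w x ^ 2 * dist x₀ x ^ r) ∂(gibbs ν U) ≤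
        ENNReal.ofReal C * ∫⁻ x, ENNReal.ofReal (‖subgrad X w x‖ ^ 2 + w x ^ 2) ∂(gibbs ν U) := by
  obtain ⟨C, hC, hbound⟩ := h.lintegral_mul_dist_rpow_le
  refine ⟨C * 2, by positivity, fun w hw => ?_⟩
  have hw2 : LipDiff n ν fun x => w x ^ 2 := hw.comp (Φ := fun t => t ^ 2) fun _ => by fun_prop
  refine (hbound _ hw2 fun x => sq_nonneg _).trans ?_
  rw [ENNReal.ofReal_mul hC.le, mul_assoc]
  gcongr
  refine lintegral_ofReal_le_mul zero_le_two ?_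
  filter_upwards [gibbs_absolutelyContinuous (hw.ae_norm_subgrad_sq_le (X := X))] with x hx
  nlinarith [sq_nonneg ‖subgrad X w x‖]

lemma exists_setLIntegral_compl_ball_sq_le (h : Confining X ν x₀ U r) :
    ∃ R : ℝ, 0 < R ∧ ∀ w : M → ℝ, LipDiff n ν w →
      ∫⁻ x in (Metric.ball x₀ R)ᶜ, ENNReal.ofReal (w x ^ 2) ∂(gibbs ν U) ≤
        ENNReal.ofReal (1 / 2) *
          ∫⁻ x, ENNReal.ofReal (‖subgrad X w x‖ ^ 2 + w x ^ 2) ∂(gibbs ν U) := by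
  obtain ⟨C, hC, hbound⟩ := h.lintegral_sq_mul_dist_rpow_le
  have hR : ((2 * C) ^ r⁻¹) ^ r = 2 * C := Real.rpow_inv_rpow (by positivity) h.pos.ne'
  refine ⟨(2 * C) ^ r⁻¹, by positivity, fun w hw => ?_⟩
  have hw2 := hw.continuous
  calc ∫⁻ x in (Metric.ball x₀ ((2 * C) ^ r⁻¹))ᶜ, ENNReal.ofReal (w x ^ 2) ∂(gibbs ν U)
      ≤ ∫⁻ x in (Metric.ball x₀ ((2 * C) ^ r⁻¹))ᶜ,
          ENNReal.ofReal ((2 * C)⁻¹ * (w x ^ 2 * dist x₀ x ^ r)) ∂(gibbs ν U) := by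
        refine setLIntegral_mono (by fun_prop) fun x hx => ENNReal.ofReal_le_ofReal ?_
        rw [mem_compl_iff, Metric.mem_ball', not_lt] at hx
        have hle := Real.rpow_le_rpow (by positivity) hx h.pos.le
        rw [hR] at hle
        rw [inv_mul_eq_div, le_div_iff₀ (by positivity)]
        exact mul_le_mul_of_nonneg_left hle (sq_nonneg _)
    _ ≤ ∫⁻ x, ENNReal.ofReal ((2 * C)⁻¹ * (w x ^ 2 * dist x₀ x ^ r)) ∂(gibbs ν U) :=
        setLIntegral_le_lintegral _ _
    _ ≤ ENNReal.ofReal (2 * C)⁻¹ * (ENNReal.ofReal C *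
          ∫⁻ x, ENNReal.ofReal (‖subgrad X w x‖ ^ 2 + w x ^ 2) ∂(gibbs ν U)) := by
        rw [lintegral_ofReal_const_mul (by positivity)]
        gcongr
        exact hbound w hw
    _ = _ := by
        rw [← mul_assoc, ← ENNReal.ofReal_mul (by positivity)]
        congr 2
        field_simp

lemma poincare [IsFiniteMeasure (gibbs ν U)] (h : Confining X ν x₀ U r)
    (hP : LocalPoincare X ν x₀) :
    ∃ C : ℝ, 0 < C ∧ ∀ v : M → ℝ, LipDiff n ν v →
      ∫⁻ x, ENNReal.ofReal (v x ^ 2) ∂(gibbs ν U) ≠ ⊤ → ∃ k : ℝ,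
        ∫⁻ x, ENNReal.ofReal ((v x - k) ^ 2) ∂(gibbs ν U) ≤
          ENNReal.ofReal C * ∫⁻ x, ENNReal.ofReal (‖subgrad X v x‖ ^ 2) ∂(gibbs ν U) := by
  obtain ⟨R, hR, hout⟩ := h.exists_setLIntegral_compl_ball_sq_le
  obtain ⟨c, hc, hin⟩ := hP.exists_setLIntegral_gibbs_sub_sq_le h.lipDiff.continuous hR
  refine ⟨2 * (c + 1 / 2), by positivity, fun v hv hv2 => ?_⟩
  obtain ⟨k, hk⟩ := hin v hv
  refine ⟨k, ?_⟩
  have hvc := hv.continuous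
  set μ := gibbs ν U
  set I := ∫⁻ x, ENNReal.ofReal ((v x - k) ^ 2) ∂μ
  set G := ∫⁻ x, ENNReal.ofReal (‖subgrad X v x‖ ^ 2) ∂μ
  have hI : I ≠ ⊤ := by
    refine ne_top_of_le_ne_top ?_ (lintegral_ofReal_le_mul_add (μ := μ) zero_le_two zero_le_two
      (f := fun x => v x ^ 2) (g := fun _ => k ^ 2) (by fun_prop)
      (Eventually.of_forall fun x => by nlinarith [sq_nonneg (v x + k)]))
    rw [lintegral_const]
    finiteness
  have hsplit : ∫⁻ x, ENNReal.ofReal (‖subgrad X (fun y => v y - k) x‖ ^ 2 + (v x - k) ^ 2) ∂μ ≤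
      G + I := by
    refine (lintegral_ofReal_le_mul_add (f := fun x => ‖subgrad X v x‖ ^ 2)
      (g := fun x => (v x - k) ^ 2) zero_le_one zero_le_one
      ((h.aemeasurable_subgrad_gibbs hv).norm.pow_const 2) ?_).trans_eq
      (by rw [ENNReal.ofReal_one, one_mul, one_mul])
    filter_upwards [gibbs_absolutelyContinuous (hv.ae_subgrad_sub_const (X := X) k)] with x hx
    rw [hx, one_mul, one_mul]
  have hhalf : ENNReal.ofReal (1 / 2) = 2⁻¹ := by
    rw [one_div, ENNReal.ofReal_inv_of_pos two_pos, ENNReal.ofReal_ofNat]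
  rw [ENNReal.ofReal_mul zero_le_two, ENNReal.ofReal_ofNat, mul_assoc]
  refine le_two_mul_of_le_add_half hI ?_
  calc I = _ := (lintegral_add_compl _ (measurableSet_ball (x := x₀) (ε := R))).symm
    _ ≤ ENNReal.ofReal c * G + ENNReal.ofReal (1 / 2) * (G + I) := by
        gcongr
        · exact hk.trans (by gcongr; exact setLIntegral_le_lintegral _ _)
        · exact (hout _ (hv.sub_const k)).trans (by gcongr)
    _ = ENNReal.ofReal (c + 1 / 2) * G + I / 2 := by
        rw [ENNReal.ofReal_add hc.le (by positivity), hhalf, ENNReal.div_eq_inv_mul]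
        ring

end Confining

end Poincare

section Saturation

/-- A smooth bounded approximation of the identity of `[0, ∞)` that increases to `t` as `T → ∞`. -/
noncomputable def saturation (T t : ℝ) : ℝ := T * t / (T + t)

variable {T t : ℝ}

lemma saturation_nonneg (hT : 0 < T) (ht : 0 ≤ t) : 0 ≤ saturation T t := by
  unfold saturation
  positivity

lemma saturation_le_self (hT : 0 < T) (ht : 0 ≤ t) : saturation T t ≤ t := by
  rw [saturation, div_le_iff₀ (by positivity)]
  nlinarith [sq_nonneg t]

lemma saturation_le (hT : 0 < T) (ht : 0 ≤ t) : saturation T t ≤ T := by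
  rw [saturation, div_le_iff₀ (by positivity)]
  nlinarith [sq_nonneg T]

lemma contDiffAt_saturation (hT : 0 < T) (ht : 0 ≤ t) : ContDiffAt ℝ 1 (saturation T) t :=
  ContDiffAt.div (by fun_prop) (by fun_prop) (by positivity)

lemma abs_deriv_saturation_le_one (hT : 0 < T) (ht : 0 ≤ t) : |deriv (saturation T) t| ≤ 1 := by
  have hTt : T + t ≠ 0 := by positivity
  have hderiv : deriv (saturation T) t = T ^ 2 / (T + t) ^ 2 := by
    refine ((((hasDerivAt_id t).const_mul T).fun_div
      ((hasDerivAt_id t).const_add T) hTt).deriv).trans ?_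
    simp only [id_eq]
    ring
  rw [hderiv, abs_of_nonneg (by positivity), div_le_one (by positivity)]
  exact pow_le_pow_left₀ hT.le (by linarith) 2

lemma tendsto_saturation (ht : 0 ≤ t) : Tendsto (fun T => saturation T t) atTop (𝓝 t) := by
  have hsub : (fun T => t - t ^ 2 / (T + t)) =ᶠ[atTop] fun T => saturation T t := by
    filter_upwards [eventually_gt_atTop 0] with T hT
    have : T + t ≠ 0 := by positivity
    unfold saturation
    field_simp
    ring
  refine Tendsto.congr' hsub ?_
  simpa using tendsto_const_nhds.sub
    ((tendsto_atTop_add_const_right atTop t tendsto_id).const_div_atTop (t ^ 2))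

end Saturation

lemma le_mul_mul_rpow_add {η k d : ℝ} (hη : 0 < η) (hr : 0 < r) (hk : 0 ≤ k) (hkd : k ≤ d) :
    k ≤ η * (k * d ^ r) + (η⁻¹) ^ r⁻¹ := by
  rcases le_total k ((η⁻¹) ^ r⁻¹) with hle | hge
  · have hd : 0 ≤ d := hk.trans hkd
    have : 0 ≤ η * (k * d ^ r) := by positivity
    linarith
  · have hone : 1 ≤ η * d ^ r := by
      rw [← inv_le_iff_one_le_mul₀' hη, ← Real.rpow_inv_rpow (inv_nonneg.2 hη.le) hr.ne']
      exact Real.rpow_le_rpow (by positivity) (hge.trans hkd) hr.le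
    have hroot : 0 ≤ (η⁻¹) ^ r⁻¹ := by positivity
    have := mul_le_mul_of_nonneg_left hone hk
    linarith

lemma LipDiff.ae_norm_subgrad_sq_mul_saturation_le (hf : LipDiff n ν f) (hu : LipDiff n ν u)
    (hu0 : ∀ x, 0 ≤ u x) (hu1 : ∀ᵐ x ∂ν, ‖subgrad X u x‖ ≤ 1) {T : ℝ} (hT : 0 < T) :
    ∀ᵐ x ∂ν, ‖subgrad X (fun y => f y ^ 2 * saturation T (u y)) x‖ ≤
      f x ^ 2 + 2 * (saturation T (u x) * (|f x| * ‖subgrad X f x‖)) := by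
  have hsq : ∀ x, ContDiffAt ℝ 1 (fun t : ℝ => t ^ 2) (f x) := fun _ => by fun_prop
  have hsat : ∀ x, ContDiffAt ℝ 1 (saturation T) (u x) := fun x => contDiffAt_saturation hT (hu0 x)
  filter_upwards [(hf.comp hsq).ae_subgrad_mul X (hu.comp hsat), hf.ae_subgrad_comp X hsq,
    hu.ae_subgrad_comp X hsat, hu1] with x hmul hcomp hcomp' hx
  have hderiv := abs_deriv_saturation_le_one hT (hu0 x)
  have hsat0 := saturation_nonneg hT (hu0 x)
  rw [hmul, hcomp, hcomp', deriv_pow_field, Nat.cast_ofNat, pow_one]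
  calc ‖f x ^ 2 • deriv (saturation T) (u x) • subgrad X u x +
        saturation T (u x) • (2 * f x) • subgrad X f x‖
      ≤ f x ^ 2 * (|deriv (saturation T) (u x)| * ‖subgrad X u x‖) +
          saturation T (u x) * (2 * |f x| * ‖subgrad X f x‖) := by
        refine (norm_add_le _ _).trans_eq ?_
        simp only [norm_smul, Real.norm_eq_abs, abs_mul, abs_two, abs_of_nonneg hsat0, abs_pow,
          sq_abs]
    _ ≤ f x ^ 2 * (1 * 1) + saturation T (u x) * (2 * |f x| * ‖subgrad X f x‖) := by gcongr
    _ = _ := by ring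

namespace Confining

lemma lintegral_norm_subgrad_sq_mul_saturation_le (h : Confining X ν x₀ U r) [BorelSpace M]
    {g b : M → ℝ} (hg : LipDiff n ν g) {η T : ℝ} (hη : 0 < η) (hT : 0 < T)
    (hyoung : ∀ᵐ x ∂ν, ∀ s : ℝ, 0 ≤ s →
      s * (|g x| * ‖subgrad X g x‖) ≤ η * s ^ (r + 1) * g x ^ 2 + b x) :
    ∫⁻ x, ENNReal.ofReal (‖subgrad X (fun x => g x ^ 2 * saturation T (dist x₀ x)) x‖ +
        g x ^ 2 * saturation T (dist x₀ x)) ∂(gibbs ν U) ≤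
      ENNReal.ofReal (3 * η) * ∫⁻ x, ENNReal.ofReal
          (g x ^ 2 * saturation T (dist x₀ x) * dist x₀ x ^ r) ∂(gibbs ν U) +
        ENNReal.ofReal (2 + (η⁻¹) ^ r⁻¹) * ∫⁻ x, ENNReal.ofReal (b x + g x ^ 2) ∂(gibbs ν U) := by
  have hcont : Continuous fun x => g x ^ 2 * saturation T (dist x₀ x) * dist x₀ x ^ r :=
    ((hg.continuous.pow 2).mul (h.lipDiff_dist.comp fun x =>
      contDiffAt_saturation hT dist_nonneg).continuous).mul h.continuous_dist_rpow
  refine lintegral_ofReal_le_mul_add (by positivity) (by positivity) hcont.aemeasurable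
    (gibbs_absolutelyContinuous ?_)
  filter_upwards [hyoung, hg.ae_norm_subgrad_sq_mul_saturation_le h.lipDiff_dist
    (fun _ => dist_nonneg) h.norm_subgrad_dist_le hT] with x hyoung hgrad
  set d := dist x₀ x
  set k := saturation T d
  have hk0 : 0 ≤ k := saturation_nonneg hT dist_nonneg
  have hkd : k ≤ d := saturation_le_self hT dist_nonneg
  have hb : 0 ≤ b x := by
    simpa [Real.zero_rpow (by linarith [h.pos] : r + 1 ≠ 0)] using hyoung 0 le_rfl
  have hpow : k ^ (r + 1) ≤ k * d ^ r := by
    rw [Real.rpow_add_one' hk0 (by linarith [h.pos]), mul_comm]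
    gcongr
    exact h.pos.le
  have hcross : k * (|g x| * ‖subgrad X g x‖) ≤ η * (k * d ^ r) * g x ^ 2 + b x :=
    (hyoung k hk0).trans (by gcongr)
  have hval : g x ^ 2 * k ≤ g x ^ 2 * (η * (k * d ^ r) + (η⁻¹) ^ r⁻¹) := by
    gcongr
    exact le_mul_mul_rpow_add hη h.pos hk0 hkd
  have hslack : 0 ≤ (η⁻¹) ^ r⁻¹ * b x + g x ^ 2 := by positivity
  linarith

variable [BorelSpace M] [IsLocallyFiniteMeasure ν] [ProperSpace M]

-- Applying the first bound to `g² d` produces `∫ g² d ^ (r + 1)` on both sides; saturating `d`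
-- makes this quantity finite, so that the right-hand occurrence can be absorbed.
lemma lintegral_sq_mul_dist_rpow_add_one_le (h : Confining X ν x₀ U r) :
    ∃ η C : ℝ, 0 < η ∧ 0 < C ∧ ∀ g b : M → ℝ, LipDiff n ν g →
      (∀ᵐ x ∂ν, ∀ s : ℝ, 0 ≤ s →
        s * (|g x| * ‖subgrad X g x‖) ≤ η * s ^ (r + 1) * g x ^ 2 + b x) →
      ∫⁻ x, ENNReal.ofReal (‖subgrad X g x‖ ^ 2 + g x ^ 2) ∂(gibbs ν U) ≠ ⊤ →
      ∫⁻ x, ENNReal.ofReal (g x ^ 2 * dist x₀ x ^ (r + 1)) ∂(gibbs ν U) ≤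
        ENNReal.ofReal C * ∫⁻ x, ENNReal.ofReal (b x + g x ^ 2) ∂(gibbs ν U) := by
  obtain ⟨C, hC, hbound⟩ := h.lintegral_mul_dist_rpow_le
  obtain ⟨C', -, hbound'⟩ := h.lintegral_sq_mul_dist_rpow_le
  set η : ℝ := 1 / (6 * C) with hη
  refine ⟨η, 2 * (C * (2 + (η⁻¹) ^ r⁻¹)), by positivity, by positivity,
    fun g b hg hyoung hfin => ?_⟩
  have hsat (j : ℕ) : LipDiff n ν fun x => g x ^ 2 * saturation (j + 1) (dist x₀ x) :=
    (hg.comp (Φ := fun t => t ^ 2) fun x => by fun_prop).mul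
      (h.lipDiff_dist.comp fun x => contDiffAt_saturation (by positivity) dist_nonneg)
  refine lintegral_ofReal_le_of_tendsto (F := fun (j : ℕ) x =>
    g x ^ 2 * saturation (j + 1) (dist x₀ x) * dist x₀ x ^ r)
    (fun j => ((hsat j).continuous.mul h.continuous_dist_rpow).aemeasurable) (fun x => ?_)
    fun j => ?_
  · rw [Real.rpow_add_one' dist_nonneg (by linarith [h.pos]), mul_comm (_ ^ r), ← mul_assoc]
    exact (((tendsto_saturation dist_nonneg).comp (tendsto_atTop_add_const_right _ 1
      tendsto_natCast_atTop_atTop)).const_mul _).mul_const _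
  have hj : (0 : ℝ) < j + 1 := by positivity
  rw [ENNReal.ofReal_mul zero_le_two, ENNReal.ofReal_ofNat, mul_assoc]
  refine le_two_mul_of_le_add_half ?_ ?_
  · refine ne_top_of_le_ne_top (ENNReal.mul_ne_top ENNReal.ofReal_ne_top
      (ne_top_of_le_ne_top (ENNReal.mul_ne_top ENNReal.ofReal_ne_top hfin) (hbound' g hg)))
      (lintegral_ofReal_le_mul hj.le (Eventually.of_forall fun x => ?_))
    calc g x ^ 2 * saturation (j + 1) (dist x₀ x) * dist x₀ x ^ r
        ≤ g x ^ 2 * (j + 1) * dist x₀ x ^ r := by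
          gcongr
          exact saturation_le hj dist_nonneg
      _ = _ := by ring
  · refine (hbound _ (hsat j) fun x =>
      mul_nonneg (sq_nonneg _) (saturation_nonneg hj dist_nonneg)).trans ?_
    grw [h.lintegral_norm_subgrad_sq_mul_saturation_le hg (by positivity) hj hyoung]
    have hthree : ENNReal.ofReal C * ENNReal.ofReal (3 * η) = 2⁻¹ := by
      rw [← ENNReal.ofReal_mul hC.le, ← ENNReal.ofReal_ofNat,
        ← ENNReal.ofReal_inv_of_pos two_pos, hη]
      congr 1
      field_simp
      norm_num
    rw [mul_add, ← mul_assoc, ← mul_assoc, hthree, ← ENNReal.ofReal_mul hC.le,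
      ENNReal.div_eq_inv_mul, add_comm]

end Confining

section DefectiveLogSobolev

lemma mul_log_le_of_le {t a b δ S : ℝ} (ht : 0 ≤ t) (hδ : 0 < δ) (hS : 0 < S) (hab : a ≤ b) :
    t * Real.log t ≤ t * b + t * Real.log S + t * (t * Real.exp (-a) / S) ^ δ / δ := by
  rcases ht.eq_or_lt with rfl | ht
  · simp
  have hlog : Real.log (t * Real.exp (-a) / S) = Real.log t - a - Real.log S := by
    rw [Real.log_div (by positivity) hS.ne', Real.log_mul ht.ne' (by positivity), Real.log_exp]
    ring
  have hle := Real.log_le_rpow_div (by positivity : 0 ≤ t * Real.exp (-a) / S) hδ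
  calc t * Real.log t
      = t * (a + Real.log S + Real.log (t * Real.exp (-a) / S)) := by
        rw [hlog]
        ring
    _ ≤ t * (b + Real.log S + (t * Real.exp (-a) / S) ^ δ / δ) := by gcongr
    _ = _ := by ring

variable {α : Type*} [MeasurableSpace α] {μ : Measure α}

lemma integrable_of_lintegral_ofReal_le {F : α → ℝ} {B : ℝ} (hF : AEStronglyMeasurable F μ)
    (hF0 : ∀ x, 0 ≤ F x) (hB : 0 ≤ B) (h : ∫⁻ x, ENNReal.ofReal (F x) ∂μ ≤ ENNReal.ofReal B) :
    Integrable F μ ∧ ∫ x, F x ∂μ ≤ B := by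
  have hint : Integrable F μ := (lintegral_ofReal_ne_top_iff_integrable hF
    (Eventually.of_forall hF0)).1 (ne_top_of_le_ne_top ENNReal.ofReal_ne_top h)
  rw [← ofReal_integral_eq_lintegral_ofReal hint (Eventually.of_forall hF0),
    ENNReal.ofReal_le_ofReal_iff hB] at h
  exact ⟨hint, h⟩

-- Jensen's inequality turns an `L^(1 + δ)` bound on the density `t e^{-U}` into an entropy bound.
lemma integrable_mul_log_of_lintegral_rpow_le [IsFiniteMeasure μ] {t U V : α → ℝ} {δ S : ℝ}
    (hδ : 0 < δ) (hS : 0 < S) (ht0 : ∀ x, 0 ≤ t x) (ht : Integrable t μ) (ht1 : ∫ x, t x ∂μ ≤ 1)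
    (hU : AEStronglyMeasurable U μ) (hUV : ∀ x, U x ≤ V x)
    (htV : Integrable (fun x => t x * V x) μ)
    (hpow : ∫⁻ x, ENNReal.ofReal (t x * (t x * Real.exp (-U x)) ^ δ) ∂μ ≤
      ENNReal.ofReal (S ^ (1 + δ))) :
    Integrable (fun x => t x * Real.log (t x)) μ ∧
      ∫ x, t x * Real.log (t x) ∂μ ≤ ∫ x, t x * V x ∂μ + (1 + δ⁻¹) * S := by
  have htm := ht.aemeasurable
  have hUm := hU.aemeasurable
  set J : α → ℝ := fun x => t x * (t x * Real.exp (-U x) / S) ^ δ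
  have hJ0 : ∀ x, 0 ≤ J x := fun x => by
    have := ht0 x
    positivity
  have hJle : ∫⁻ x, ENNReal.ofReal (J x) ∂μ ≤ ENNReal.ofReal S := by
    have hscale : ∀ x, J x = (S ^ δ)⁻¹ * (t x * (t x * Real.exp (-U x)) ^ δ) := fun x => by
      simp only [J, Real.div_rpow (mul_nonneg (ht0 x) (Real.exp_nonneg _)) hS.le]
      ring
    simp_rw [hscale]
    rw [lintegral_ofReal_const_mul (by positivity)]
    grw [hpow]
    rw [← ENNReal.ofReal_mul (by positivity), Real.rpow_add hS, Real.rpow_one,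
      inv_mul_eq_div, mul_div_cancel_right₀ _ (by positivity)]
  obtain ⟨hJi, hJS⟩ := integrable_of_lintegral_ofReal_le
    (AEMeasurable.aestronglyMeasurable (by fun_prop)) hJ0 hS.le hJle
  have hupper : ∀ x, t x * Real.log (t x) ≤ t x * V x + t x * Real.log S + J x / δ :=
    fun x => mul_log_le_of_le (ht0 x) hδ hS (hUV x)
  have hVS : Integrable (fun x => t x * V x + t x * Real.log S) μ := htV.add (ht.mul_const _)
  have hui : Integrable (fun x => t x * V x + t x * Real.log S + J x / δ) μ :=
    hVS.add (hJi.div_const δ)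
  have hlog : Integrable (fun x => t x * Real.log (t x)) μ :=
    integrable_of_le_of_le (AEMeasurable.aestronglyMeasurable (by fun_prop))
      (Eventually.of_forall fun x => Real.self_sub_one_le_mul_log (ht0 x))
      (Eventually.of_forall hupper) (ht.sub (integrable_const 1)) hui
  refine ⟨hlog, (integral_mono hlog hui hupper).trans ?_⟩
  rw [integral_add hVS (hJi.div_const δ), integral_add htV (ht.mul_const _), integral_mul_const,
    integral_div]
  have hN0 : 0 ≤ ∫ x, t x ∂μ := integral_nonneg ht0
  have hlogS : (∫ x, t x ∂μ) * Real.log S ≤ S :=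
    (mul_le_mul_of_nonneg_left (Real.log_le_self hS.le) hN0).trans
      (mul_le_of_le_one_left hS.le ht1)
  rw [add_mul, one_mul, inv_mul_eq_div, ← add_assoc]
  gcongr

lemma rpow_sq_le_one_add_rpow_add_one {d : ℝ} (hd : 0 ≤ d) (hr : 0 ≤ r) (hr1 : r ≤ 1) :
    (d ^ r) ^ 2 ≤ 1 + d ^ (r + 1) := by
  rw [← Real.rpow_mul_natCast hd]
  rcases le_total d 1 with hd1 | hd1
  · exact (Real.rpow_le_one hd hd1 (by positivity)).trans (by simp [Real.rpow_nonneg hd])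
  · have := Real.rpow_le_rpow_of_exponent_le hd1
      (by rw [Nat.cast_ofNat]; linarith : r * (2 : ℕ) ≤ r + 1)
    linarith

lemma LipDiff.mul_exp_neg_half (hf : LipDiff n ν f) (hU : LipDiff n ν U) :
    LipDiff n ν fun x => f x * Real.exp (-(U x / 2)) :=
  hf.mul_exp_neg (hU.comp (Φ := (· / 2)) fun _ => by fun_prop)

lemma sq_mul_exp_neg_half (a b : ℝ) :
    (a * Real.exp (-(b / 2))) ^ 2 = a ^ 2 * Real.exp (-b) := by
  rw [mul_pow, ← Real.exp_nat_mul]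
  congr 2
  push_cast
  ring

lemma LipDiff.ae_norm_subgrad_mul_exp_neg_half_sq_le (hf : LipDiff n ν f) (hU : LipDiff n ν U) :
    ∀ᵐ x ∂ν, ‖subgrad X (fun y => f y * Real.exp (-(U y / 2))) x‖ ^ 2 ≤
      Real.exp (-U x) * (2 * ‖subgrad X f x‖ ^ 2 + ‖subgrad X U x‖ ^ 2 / 2 * f x ^ 2) := by
  have hhalf : ∀ x, ContDiffAt ℝ 1 (· / 2) (U x) := fun _ => by fun_prop
  filter_upwards [hf.ae_subgrad_mul_exp_neg (X := X) (hU.comp hhalf), hU.ae_subgrad_comp X hhalf]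
    with x hmul hcomp
  rw [hmul, hcomp, deriv_div_const, deriv_id'', norm_smul, mul_pow,
    Real.norm_of_nonneg (Real.exp_nonneg _), ← Real.exp_nat_mul]
  have hexp : Real.exp ((2 : ℕ) * -(U x / 2)) = Real.exp (-U x) := by
    congr 1
    push_cast
    ring
  rw [hexp]
  gcongr
  calc ‖subgrad X f x - f x • (1 / 2 : ℝ) • subgrad X U x‖ ^ 2
      ≤ (‖subgrad X f x‖ + |f x| * (1 / 2 * ‖subgrad X U x‖)) ^ 2 := by
        gcongr
        refine (norm_sub_le _ _).trans_eq ?_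
        rw [norm_smul, norm_smul, Real.norm_eq_abs, Real.norm_of_nonneg one_half_pos.le]
    _ ≤ 2 * (‖subgrad X f x‖ ^ 2 + (|f x| * (1 / 2 * ‖subgrad X U x‖)) ^ 2) := add_sq_le
    _ = _ := by
        rw [mul_pow, sq_abs]
        ring

namespace Confining

lemma exists_ae_norm_subgrad_mul_exp_neg_half_sq_le (h : Confining X ν x₀ U r) :
    ∃ D : ℝ, 0 < D ∧ ∀ g : M → ℝ, LipDiff n ν g →
      ∀ᵐ x ∂ν, ‖subgrad X (fun y => g y * Real.exp (-(U y / 2))) x‖ ^ 2 +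
          (g x * Real.exp (-(U x / 2))) ^ 2 ≤
        D * (Real.exp (-U x) * (‖subgrad X g x‖ ^ 2 + g x ^ 2 * (1 + dist x₀ x ^ (r + 1)))) := by
  obtain ⟨A, hA, hgrowth⟩ := h.norm_subgrad_le
  refine ⟨2 * A ^ 2 + 3, by positivity, fun g hg => ?_⟩
  filter_upwards [hg.ae_norm_subgrad_mul_exp_neg_half_sq_le h.lipDiff, hgrowth] with x hx hgrowth
  set d := dist x₀ x
  have hU : ‖subgrad X U x‖ ^ 2 / 2 ≤ 2 * A ^ 2 * (1 + d ^ (r + 1)) := by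
    calc ‖subgrad X U x‖ ^ 2 / 2 ≤ A ^ 2 * (1 + d ^ r) ^ 2 / 2 := by
          rw [← mul_pow]
          gcongr
      _ ≤ A ^ 2 * (4 * (1 + d ^ (r + 1))) / 2 := by
          gcongr
          have hsq := rpow_sq_le_one_add_rpow_add_one (dist_nonneg (x := x₀) (y := x)) h.pos.le
            h.le_one
          have hd : 0 ≤ d ^ (r + 1) := by positivity
          linarith [add_sq_le (a := 1) (b := d ^ r)]
      _ = _ := by ring
  calc ‖subgrad X (fun y => g y * Real.exp (-(U y / 2))) x‖ ^ 2 +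
        (g x * Real.exp (-(U x / 2))) ^ 2
      ≤ Real.exp (-U x) * (2 * ‖subgrad X g x‖ ^ 2 +
          2 * A ^ 2 * (1 + d ^ (r + 1)) * g x ^ 2 + g x ^ 2 * 1) := by
        rw [sq_mul_exp_neg_half, mul_one, mul_add, mul_comm (g x ^ 2) (Real.exp _)]
        refine add_le_add_left (hx.trans ?_) _
        gcongr
    _ ≤ Real.exp (-U x) * ((2 * A ^ 2 + 3) *
          (‖subgrad X g x‖ ^ 2 + g x ^ 2 * (1 + d ^ (r + 1)))) := by
        refine mul_le_mul_of_nonneg_left ?_ (Real.exp_nonneg _)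
        have hgrad : 0 ≤ (2 * A ^ 2 + 1) * ‖subgrad X g x‖ ^ 2 := by positivity
        have hval : 0 ≤ g x ^ 2 * (3 * d ^ (r + 1) + 2) := by positivity
        linarith
    _ = _ := by ring

variable [BorelSpace M] [ProperSpace M] {ε α β : ℝ}

lemma exists_lintegral_sq_mul_rpow_le (h : Confining X ν x₀ U r)
    (hε : 0 < ε) (hα : 0 < α) (hβ : 0 ≤ β) (hS : ClassicalSobolev X ν ε α β) :
    ∃ A : ℝ, 0 < A ∧ ∀ (g : M → ℝ) (E : ℝ), LipDiff n ν g → 0 ≤ E →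
      ∫⁻ x, ENNReal.ofReal (‖subgrad X g x‖ ^ 2 + g x ^ 2 * (1 + dist x₀ x ^ (r + 1)))
        ∂(gibbs ν U) ≤ ENNReal.ofReal E →
      ∫⁻ x, ENNReal.ofReal (g x ^ 2 * (g x ^ 2 * Real.exp (-U x)) ^ (ε / 2)) ∂(gibbs ν U) ≤
        ENNReal.ofReal ((A * E) ^ (1 + ε / 2)) := by
  obtain ⟨A, hA, hSob⟩ := hS.exists_lintegral_rpow_le hε hα hβ h.lipDiff_dist h.norm_subgrad_dist_le
  obtain ⟨D, hD, hgrad⟩ := h.exists_ae_norm_subgrad_mul_exp_neg_half_sq_le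
  refine ⟨A * D, by positivity, fun g E hg hE0 hE => ?_⟩
  have hpow (x : M) : Real.exp (-U x) * (g x ^ 2 * (g x ^ 2 * Real.exp (-U x)) ^ (ε / 2)) =
      |g x * Real.exp (-(U x / 2))| ^ (2 + ε) := by
    rw [Real.rpow_add' (abs_nonneg _) (by positivity), Real.rpow_two, sq_abs,
      ← sq_mul_exp_neg_half, ← sq_abs (_ * _), ← Real.rpow_natCast_mul (abs_nonneg _),
      Nat.cast_ofNat, mul_div_cancel₀ _ two_ne_zero, sq_abs, sq_mul_exp_neg_half]
    ring
  rw [lintegral_ofReal_gibbs h.lipDiff.continuous]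
  simp_rw [hpow]
  calc _ ≤ _ := hSob _ (hg.mul_exp_neg_half h.lipDiff)
    _ ≤ (ENNReal.ofReal A * (ENNReal.ofReal D * ENNReal.ofReal E)) ^ ((2 + ε) / 2) := by
        gcongr
        grw [lintegral_ofReal_le_mul hD.le (hgrad g hg), ← hE,
          lintegral_ofReal_gibbs h.lipDiff.continuous]
    _ = ENNReal.ofReal ((A * D * E) ^ (1 + ε / 2)) := by
        rw [← ENNReal.ofReal_mul hD.le, ← ENNReal.ofReal_mul hA.le,
          ENNReal.ofReal_rpow_of_nonneg (by positivity) (by positivity)]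
        ring_nf

lemma defective_logSobolev [IsFiniteMeasure (gibbs ν U)] (h : Confining X ν x₀ U r)
    (hε : 0 < ε) (hα : 0 < α) (hβ : 0 ≤ β) (hS : ClassicalSobolev X ν ε α β) :
    ∃ C : ℝ, 0 < C ∧ ∀ (g : M → ℝ) (E : ℝ), LipDiff n ν g → ∫ x, g x ^ 2 ∂(gibbs ν U) ≤ 1 → 0 < E →
      ∫⁻ x, ENNReal.ofReal (‖subgrad X g x‖ ^ 2 + g x ^ 2 * (1 + dist x₀ x ^ (r + 1)))
        ∂(gibbs ν U) ≤ ENNReal.ofReal E →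
      Integrable (fun x => g x ^ 2 * Real.log (g x ^ 2)) (gibbs ν U) ∧
        ∫ x, g x ^ 2 * Real.log (g x ^ 2) ∂(gibbs ν U) ≤ C * E := by
  obtain ⟨A, hA, hpow⟩ := h.exists_lintegral_sq_mul_rpow_le hε hα hβ hS
  obtain ⟨B, hB, hUle⟩ := h.potential_le
  refine ⟨B + (1 + (ε / 2)⁻¹) * A, by positivity, fun g E hg hg1 hE hgE => ?_⟩
  have hd : Continuous fun x => dist x₀ x ^ (r + 1) :=
    (continuous_const.dist continuous_id).rpow_const fun _ => Or.inr (by linarith [h.pos])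
  have hgc := hg.continuous
  set Q : M → ℝ := fun x => g x ^ 2 * (1 + dist x₀ x ^ (r + 1))
  have hQE : ∫⁻ x, ENNReal.ofReal (Q x) ∂(gibbs ν U) ≤ ENNReal.ofReal E :=
    (lintegral_ofReal_mono_ae (Eventually.of_forall fun x =>
      le_add_of_nonneg_left (sq_nonneg _))).trans hgE
  obtain ⟨hQi, hQle⟩ := integrable_of_lintegral_ofReal_le
    (Continuous.aestronglyMeasurable (by fun_prop)) (fun x => by positivity) hE.le hQE
  have hg2 : Integrable (fun x => g x ^ 2) (gibbs ν U) :=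
    hQi.mono' (by fun_prop) (Eventually.of_forall fun x => by
      rw [Real.norm_of_nonneg (sq_nonneg _)]
      exact le_mul_of_one_le_right (sq_nonneg _) (le_add_of_nonneg_right (by positivity)))
  have hQB : ∀ x, g x ^ 2 * (B * (1 + dist x₀ x ^ (r + 1))) = B * Q x := fun x => by ring
  obtain ⟨hint, hle⟩ := integrable_mul_log_of_lintegral_rpow_le (half_pos hε) (mul_pos hA hE)
    (fun x => sq_nonneg (g x)) hg2 hg1 h.lipDiff.continuous.aestronglyMeasurable hUle
    ((hQi.const_mul B).congr (Eventually.of_forall fun x => (hQB x).symm)) (hpow g E hg hE.le hgE)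
  refine ⟨hint, hle.trans ?_⟩
  simp_rw [hQB]
  rw [integral_const_mul, add_mul B, mul_assoc (1 + _) A E]
  gcongr

end Confining

end DefectiveLogSobolev

section Truncation

variable {q p p' A C η s t z : ℝ} {k : ℕ}

lemma Hq_nonneg (q t : ℝ) : 0 ≤ Hq q t := by
  unfold Hq
  split_ifs <;> positivity

lemma abs_rpow_le_Hq (hs : 2 ≤ s) (hsq : s ≤ q) : |t| ^ s ≤ Hq q t := by
  unfold Hq
  split_ifs with ht
  · rw [← sq_abs t, ← Real.rpow_two]
    exact Real.rpow_le_rpow_of_exponent_ge_of_imp (abs_nonneg t) ht hs fun _ h => by linarith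
  · exact Real.rpow_le_rpow_of_exponent_le (not_le.1 ht).le hsq

lemma sq_le_Hq_div_mul_sq (hq : 2 ≤ q) (ht : t ≠ 0) : z ^ 2 ≤ Hq q (z / t) * t ^ 2 := by
  have h : |z / t| ^ (2 : ℝ) ≤ Hq q (z / t) := abs_rpow_le_Hq le_rfl hq
  rwa [Real.rpow_two, sq_abs, div_pow, div_le_iff₀ (by positivity)] at h

lemma exists_mul_le_rpow_add_rpow (hp : p.HolderConjugate p') (hη : 0 < η) :
    ∃ C : ℝ, 0 < C ∧ ∀ s w : ℝ, 0 ≤ s → 0 ≤ w → s * w ≤ η * s ^ p + C * w ^ p' := by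
  set l := η ^ p⁻¹
  have hl : 0 < l := by positivity
  have hlp : l ^ p = η := Real.rpow_inv_rpow hη.le hp.ne_zero
  refine ⟨(l⁻¹) ^ p', by positivity, fun s w hs hw => ?_⟩
  calc s * w = (l * s) * (l⁻¹ * w) := by field_simp
    _ ≤ (l * s) ^ p / p + (l⁻¹ * w) ^ p' / p' :=
        Real.young_inequality_of_nonneg (by positivity) (by positivity) hp
    _ ≤ (l * s) ^ p + (l⁻¹ * w) ^ p' :=
        add_le_add (div_le_self (by positivity) hp.lt.le)
          (div_le_self (by positivity) hp.symm.lt.le)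
    _ = η * s ^ p + l⁻¹ ^ p' * w ^ p' := by
        rw [Real.mul_rpow hl.le hs, Real.mul_rpow (by positivity) hw, hlp]

/-- A smooth function of `t`, equal to `0` where `t² ≤ 2` and to `1` where `t² ≥ 3`. -/
noncomputable def truncationFactor (t : ℝ) : ℝ := Real.smoothTransition (t ^ 2 - 2)

lemma truncationFactor_nonneg (t : ℝ) : 0 ≤ truncationFactor t := Real.smoothTransition.nonneg _

lemma truncationFactor_le_one (t : ℝ) : truncationFactor t ≤ 1 := Real.smoothTransition.le_one _

lemma truncationFactor_of_sq_le (ht : t ^ 2 ≤ 2) : truncationFactor t = 0 :=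
  Real.smoothTransition.zero_of_nonpos (by linarith)

lemma truncationFactor_of_le_sq (ht : 3 ≤ t ^ 2) : truncationFactor t = 1 :=
  Real.smoothTransition.one_of_one_le (by linarith)

lemma contDiff_truncationFactor : ContDiff ℝ 1 truncationFactor :=
  Real.smoothTransition.contDiff.comp (by fun_prop)

lemma exists_abs_mul_deriv_truncationFactor_le :
    ∃ C : ℝ, 0 < C ∧ ∀ t, |t * deriv truncationFactor t| ≤ C := by
  have hsupp : HasCompactSupport fun t => 1 - truncationFactor t := by
    refine HasCompactSupport.intro (isCompact_Icc (a := (-2 : ℝ)) (b := 2)) fun t ht => ?_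
    rw [truncationFactor_of_le_sq, sub_self]
    by_contra! h
    exact ht (abs_le.1 (by nlinarith [sq_abs t, abs_nonneg t]))
  have hderiv : deriv (fun t => 1 - truncationFactor t) = fun t => -deriv truncationFactor t :=
    funext fun t => deriv_const_sub 1
  have hcont : Continuous fun t => t * -deriv truncationFactor t :=
    continuous_id.mul (contDiff_truncationFactor.continuous_deriv le_rfl).neg
  obtain ⟨C, hC⟩ := (hderiv ▸ hsupp.deriv).mul_left.exists_bound_of_continuous hcont
  refine ⟨|C| + 1, by positivity, fun t => ?_⟩
  have h : ‖t * -deriv truncationFactor t‖ ≤ C := hC t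
  rw [mul_neg, norm_neg, Real.norm_eq_abs] at h
  linarith [le_abs_self C]

/-- A smooth truncation of the identity away from `0`, vanishing to the order `k` at the boundary of
its support. -/
noncomputable def truncation (k : ℕ) (t : ℝ) : ℝ := t * truncationFactor t ^ (k + 1)

lemma truncation_of_sq_le (k : ℕ) (ht : t ^ 2 ≤ 2) : truncation k t = 0 := by
  simp [truncation, truncationFactor_of_sq_le ht]

lemma truncation_of_le_sq (k : ℕ) (ht : 3 ≤ t ^ 2) : truncation k t = t := by
  simp [truncation, truncationFactor_of_le_sq ht]

lemma contDiff_truncation (k : ℕ) : ContDiff ℝ 1 (truncation k) :=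
  contDiff_id.mul (contDiff_truncationFactor.pow (k + 1))

lemma exists_abs_deriv_truncation_le (k : ℕ) :
    ∃ A : ℝ, 0 < A ∧ ∀ t, |deriv (truncation k) t| ≤ A * truncationFactor t ^ k := by
  obtain ⟨C, hC, hCb⟩ := exists_abs_mul_deriv_truncationFactor_le
  refine ⟨1 + (k + 1) * C, by positivity, fun t => ?_⟩
  have hder : deriv (truncation k) t =
      (truncationFactor t + (k + 1) * (t * deriv truncationFactor t)) * truncationFactor t ^ k := by
    have h := (hasDerivAt_id t).fun_mul
      ((contDiff_truncationFactor.differentiable one_ne_zero t).hasDerivAt.fun_pow (k + 1))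
    refine h.deriv.trans ?_
    simp only [id, Nat.add_sub_cancel, Nat.cast_add, Nat.cast_one]
    ring
  have hτ := truncationFactor_nonneg t
  rw [hder, abs_mul, abs_of_nonneg (pow_nonneg hτ k)]
  gcongr
  refine (abs_add_le _ _).trans (add_le_add ?_ ?_)
  · exact (abs_of_nonneg hτ).trans_le (truncationFactor_le_one t)
  · rw [abs_mul, abs_of_nonneg (by positivity : (0 : ℝ) ≤ k + 1)]
    gcongr
    exact hCb t

lemma sq_truncation_le (k : ℕ) (t : ℝ) : truncation k t ^ 2 ≤ t ^ 2 := by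
  rw [truncation, mul_pow]
  exact mul_le_of_le_one_right (sq_nonneg _) (pow_le_one₀ (pow_nonneg (truncationFactor_nonneg t) _)
    (pow_le_one₀ (truncationFactor_nonneg t) (truncationFactor_le_one t)))

lemma sq_truncation_le_abs_sub_one_sq (k : ℕ) (t : ℝ) :
    truncation k t ^ 2 ≤ 16 * (|t| - 1) ^ 2 := by
  rcases le_or_gt (t ^ 2) 2 with ht | ht
  · rw [truncation_of_sq_le k ht, zero_pow two_ne_zero]
    positivity
  · nlinarith [sq_truncation_le k t, sq_abs t]

lemma sq_mul_log_sq_le (k : ℕ) (t : ℝ) :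
    t ^ 2 * Real.log (t ^ 2) ≤ t ^ 2 - 1 + 25 * (|t| - 1) ^ 2 +
      truncation k t ^ 2 * Real.log (truncation k t ^ 2) := by
  rcases le_or_gt 3 (t ^ 2) with ht | ht
  · rw [truncation_of_le_sq k ht]
    nlinarith [sq_nonneg (|t| - 1)]
  have hupper : t ^ 2 * Real.log (t ^ 2) ≤ t ^ 2 - 1 + 9 * (|t| - 1) ^ 2 := by
    rcases eq_or_ne t 0 with rfl | h0
    · simp
    have hlog : t ^ 2 * Real.log (t ^ 2) ≤ t ^ 2 * (t ^ 2 - 1) :=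
      mul_le_mul_of_nonneg_left (Real.log_le_sub_one_of_pos (by positivity)) (sq_nonneg t)
    have hsq : (t ^ 2 - 1) ^ 2 ≤ 9 * (|t| - 1) ^ 2 := by
      rw [← sq_abs t, show (|t| ^ 2 - 1) ^ 2 = (|t| + 1) ^ 2 * (|t| - 1) ^ 2 by ring]
      gcongr
      nlinarith [sq_abs t, abs_nonneg t]
    linarith
  have hlower : -(16 * (|t| - 1) ^ 2) ≤ truncation k t ^ 2 * Real.log (truncation k t ^ 2) := by
    rcases le_or_gt (t ^ 2) 2 with ht2 | ht2
    · rw [truncation_of_sq_le k ht2]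
      simpa using sq_nonneg (|t| - 1)
    · have habs : 4 / 3 ≤ |t| := by nlinarith [sq_abs t, abs_nonneg t]
      have hlog := Real.self_sub_one_le_mul_log (sq_nonneg (truncation k t))
      nlinarith [sq_nonneg (truncation k t)]
  linarith

lemma sq_deriv_truncation_mul_le (hq : 2 ≤ q) (hk : k ≠ 0)
    (hA : ∀ t, |deriv (truncation k) t| ≤ A * truncationFactor t ^ k) (t z : ℝ) :
    (deriv (truncation k) t * z) ^ 2 ≤ A ^ 2 * (Hq q (z / t) * t ^ 2) := by
  rcases eq_or_ne t 0 with rfl | ht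
  · have h := hA 0
    rw [truncationFactor_of_sq_le (by norm_num), zero_pow hk, mul_zero, abs_nonpos_iff] at h
    simp [h]
  have hτ := pow_nonneg (truncationFactor_nonneg t) k
  have hτ1 := pow_le_one₀ (n := k) (truncationFactor_nonneg t) (truncationFactor_le_one t)
  have hderiv : deriv (truncation k) t ^ 2 ≤ A ^ 2 :=
    calc deriv (truncation k) t ^ 2 ≤ (A * truncationFactor t ^ k) ^ 2 :=
          sq_le_sq' (abs_le.1 (hA t)).1 (abs_le.1 (hA t)).2
      _ ≤ A ^ 2 := by
          rw [mul_pow]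
          exact mul_le_of_le_one_right (sq_nonneg A) (pow_le_one₀ hτ hτ1)
  rw [mul_pow]
  exact mul_le_mul hderiv (sq_le_Hq_div_mul_sq hq ht) (sq_nonneg z) (sq_nonneg A)

lemma sq_truncation_mul_div_rpow_le (hp' : 2 ≤ p') (hp'q : p' ≤ q) (hk : q ≤ 2 * (k + 1))
    (hA : 0 ≤ A) (hz : 0 ≤ z) (ht : truncation k t ≠ 0) :
    truncation k t ^ 2 * (A * z / (truncationFactor t * |t|)) ^ p' ≤
      A ^ p' * (Hq q (z / t) * t ^ 2) := by
  have hτ : 0 < truncationFactor t :=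
    (truncationFactor_nonneg t).lt_of_ne fun h => ht (by simp [truncation, ← h])
  have hsplit : A * z / (truncationFactor t * |t|) = A * ((truncationFactor t)⁻¹ * |z / t|) := by
    rw [abs_div, abs_of_nonneg hz]
    field_simp
  have hpow : (truncationFactor t ^ (k + 1)) ^ 2 ≤ truncationFactor t ^ p' := by
    rw [← pow_mul, ← Real.rpow_natCast]
    refine Real.rpow_le_rpow_of_exponent_ge hτ (truncationFactor_le_one t) ?_
    push_cast
    linarith
  calc truncation k t ^ 2 * (A * z / (truncationFactor t * |t|)) ^ p'
      = A ^ p' * (|z / t| ^ p' *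
          (t ^ 2 * ((truncationFactor t ^ (k + 1)) ^ 2 / truncationFactor t ^ p'))) := by
        rw [hsplit, Real.mul_rpow hA (by positivity), Real.mul_rpow (by positivity) (abs_nonneg _),
          Real.inv_rpow hτ.le, truncation]
        ring
    _ ≤ A ^ p' * (Hq q (z / t) * t ^ 2) := by
        gcongr
        · exact Hq_nonneg q _
        · exact abs_rpow_le_Hq hp' hp'q
        · exact mul_le_of_le_one_right (sq_nonneg t) (div_le_one_of_le₀ hpow (by positivity))

-- Young's inequality applied with `w = A z / (τ |t|)`; the order of vanishing of the truncation
-- compensates for the negative power of `τ` in `w ^ p'`.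
lemma mul_abs_truncation_mul_deriv_le (hp' : 2 ≤ p') (hp'q : p' ≤ q) (hk : q ≤ 2 * (k + 1))
    (hA0 : 0 < A) (hA : ∀ t, |deriv (truncation k) t| ≤ A * truncationFactor t ^ k) (hC : 0 ≤ C)
    (hyoung : ∀ s w : ℝ, 0 ≤ s → 0 ≤ w → s * w ≤ η * s ^ p + C * w ^ p')
    (hs : 0 ≤ s) (hz : 0 ≤ z) :
    s * (|truncation k t| * (|deriv (truncation k) t| * z)) ≤
      η * s ^ p * truncation k t ^ 2 + C * A ^ p' * (Hq q (z / t) * t ^ 2) := by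
  rcases eq_or_ne (truncation k t) 0 with h0 | h0
  · have hrhs : 0 ≤ C * A ^ p' * (Hq q (z / t) * t ^ 2) :=
      mul_nonneg (by positivity) (mul_nonneg (Hq_nonneg q _) (sq_nonneg t))
    simpa [h0] using hrhs
  have hτ := truncationFactor_nonneg t
  set w : ℝ := A * z / (truncationFactor t * |t|)
  have hw : |deriv (truncation k) t| * z ≤ |truncation k t| * w := by
    have ht : t ≠ 0 := fun h => h0 (by simp [truncation, h])
    have hτ0 : truncationFactor t ≠ 0 := fun h => h0 (by simp [truncation, h])
    refine (mul_le_mul_of_nonneg_right (hA t) hz).trans_eq ?_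
    rw [truncation, abs_mul, abs_of_nonneg (pow_nonneg hτ _)]
    simp only [w]
    field_simp
    ring
  calc s * (|truncation k t| * (|deriv (truncation k) t| * z))
      ≤ s * (|truncation k t| * (|truncation k t| * w)) := by gcongr
    _ = truncation k t ^ 2 * (s * w) := by
        rw [← sq_abs (truncation k t)]
        ring
    _ ≤ truncation k t ^ 2 * (η * s ^ p + C * w ^ p') := by
        gcongr
        exact hyoung s w hs (by positivity)
    _ = η * s ^ p * truncation k t ^ 2 + C * (truncation k t ^ 2 * w ^ p') := by ring
    _ ≤ η * s ^ p * truncation k t ^ 2 + C * (A ^ p' * (Hq q (z / t) * t ^ 2)) := by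
        gcongr _ + C * ?_
        exact sq_truncation_mul_div_rpow_le hp' hp'q hk hA0.le hz h0
    _ = η * s ^ p * truncation k t ^ 2 + C * A ^ p' * (Hq q (z / t) * t ^ 2) := by ring

end Truncation

section ModifiedLogSobolev

lemma hasDerivAt_sqrt_sq_add {η : ℝ} (hη : 0 < η) (t : ℝ) :
    HasDerivAt (fun t => √(t ^ 2 + η)) (t / √(t ^ 2 + η)) t := by
  have h := (((hasDerivAt_pow 2 t).add_const η).sqrt (by positivity))
  refine h.congr_deriv ?_
  rw [Nat.cast_ofNat, Nat.add_one_sub_one, pow_one, mul_div_mul_left _ _ two_ne_zero]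

lemma LipDiff.sqrt_sq_add (hf : LipDiff n ν f) {η : ℝ} (hη : 0 < η) :
    LipDiff n ν fun x => √(f x ^ 2 + η) :=
  hf.comp (Φ := fun t => √(t ^ 2 + η)) fun _ => ContDiffAt.sqrt (by fun_prop) (by positivity)

lemma LipDiff.ae_norm_subgrad_sqrt_sq_add (X : Fin m → (x : M) → TangentSpace (𝓡 n) x)
    (hf : LipDiff n ν f) {η : ℝ} (hη : 0 < η) :
    ∀ᵐ x ∂ν, ‖subgrad X (fun y => √(f y ^ 2 + η)) x‖ =
      |f x| / √(f x ^ 2 + η) * ‖subgrad X f x‖ := by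
  filter_upwards [hf.2] with x hx
  rw [subgrad_comp hx (hasDerivAt_sqrt_sq_add hη (f x)), norm_smul, norm_div, Real.norm_eq_abs,
    Real.norm_of_nonneg (Real.sqrt_nonneg _)]

lemma abs_div_sqrt_sq_add_le_one {η : ℝ} (hη : 0 ≤ η) (t : ℝ) : |t| / √(t ^ 2 + η) ≤ 1 :=
  div_le_one_of_le₀ (Real.abs_le_sqrt (by linarith)) (Real.sqrt_nonneg _)

/-- The integrand `H_q(|∇f| / f) f²` of the modified logarithmic Sobolev inequality. -/
noncomputable def energyDensity (X : Fin m → (x : M) → TangentSpace (𝓡 n) x) (q : ℝ) (f : M → ℝ)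
    (x : M) : ℝ := Hq q (‖subgrad X f x‖ / f x) * f x ^ 2

variable {q : ℝ}

lemma energyDensity_nonneg {M : Type*} [MetricSpace M] [ChartedSpace (EuclideanSpace ℝ (Fin n)) M]
    {X : Fin m → (x : M) → TangentSpace (𝓡 n) x} {f : M → ℝ} (x : M) : 0 ≤ energyDensity X q f x :=
  mul_nonneg (Hq_nonneg _ _) (sq_nonneg _)

lemma LipDiff.ae_norm_subgrad_sqrt_sq_add_sq_le (X : Fin m → (x : M) → TangentSpace (𝓡 n) x)
    (hf : LipDiff n ν f) (hq : 2 ≤ q) {η : ℝ} (hη : 0 < η) :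
    ∀ᵐ x ∂ν, ‖subgrad X (fun y => √(f y ^ 2 + η)) x‖ ^ 2 ≤ energyDensity X q f x := by
  filter_upwards [hf.ae_norm_subgrad_sqrt_sq_add X hη] with x hx
  rw [hx]
  rcases eq_or_ne (f x) 0 with h0 | h0
  · simpa [h0] using energyDensity_nonneg x
  · refine le_trans ?_ (sq_le_Hq_div_mul_sq hq h0)
    gcongr
    exact mul_le_of_le_one_left (norm_nonneg _) (abs_div_sqrt_sq_add_le_one hη.le _)

lemma integral_sub_one_sq_le {α : Type*} [MeasurableSpace α] {μ : Measure α}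
    [IsProbabilityMeasure μ] {v : α → ℝ} (hv : MemLp v 2 μ) (hv0 : ∀ x, 0 ≤ v x)
    (hv1 : ∫ x, v x ^ 2 ∂μ = 1) (k : ℝ) :
    ∫ x, (v x - 1) ^ 2 ∂μ ≤ 2 * ∫ x, (v x - k) ^ 2 ∂μ := by
  have hint : Integrable v μ := hv.integrable one_le_two
  set a := ∫ x, v x ∂μ
  have hexpand (k : ℝ) : ∫ x, (v x - k) ^ 2 ∂μ = 1 - 2 * k * a + k ^ 2 := by
    have hlin : Integrable (fun x => 2 * k * v x) μ := hint.const_mul _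
    have hsub : Integrable (fun x => v x ^ 2 - 2 * k * v x) μ := hv.integrable_sq.sub hlin
    simp_rw [show ∀ x, (v x - k) ^ 2 = v x ^ 2 - 2 * k * v x + k ^ 2 by intro x; ring]
    rw [integral_add hsub (integrable_const _),
      integral_sub hv.integrable_sq hlin, integral_const_mul, hv1, integral_const, probReal_univ,
      one_smul]
  have ha0 : 0 ≤ a := integral_nonneg hv0
  have hvar : 0 ≤ ∫ x, (v x - a) ^ 2 ∂μ := integral_nonneg fun x => sq_nonneg _
  have ha1 : a ≤ 1 := by
    rw [hexpand] at hvar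
    nlinarith
  rw [hexpand, hexpand]
  nlinarith [sq_nonneg (k - a)]

lemma abs_sub_sq_le_sqrt_sq_add {η : ℝ} (hη : 0 ≤ η) (t k : ℝ) :
    (|t| - k) ^ 2 ≤ 2 * (√(t ^ 2 + η) - k) ^ 2 + 2 * η := by
  have habs : |t| ≤ √(t ^ 2 + η) := Real.abs_le_sqrt (by linarith)
  have hsq : √(t ^ 2 + η) ^ 2 = t ^ 2 + η := Real.sq_sqrt (by positivity)
  have hdiff : (√(t ^ 2 + η) - |t|) ^ 2 ≤ η := by nlinarith [sq_abs t, abs_nonneg t]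
  nlinarith [sq_nonneg ((√(t ^ 2 + η) - k) + (√(t ^ 2 + η) - |t|))]

namespace Confining

variable [BorelSpace M] [ProperSpace M] [IsLocallyFiniteMeasure ν]

-- Poincaré is applied to `√(f² + η)`, which unlike `|f|` is differentiable wherever `f` is.
lemma integral_abs_sub_one_sq_le [IsProbabilityMeasure (gibbs ν U)] (h : Confining X ν x₀ U r)
    (hP : LocalPoincare X ν x₀) (hq : 2 ≤ q) :
    ∃ C : ℝ, 0 < C ∧ ∀ (f : M → ℝ) (E : ℝ), LipDiff n ν f → MemLp f 2 (gibbs ν U) →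
      ∫ x, f x ^ 2 ∂(gibbs ν U) = 1 → 0 ≤ E →
      ∫⁻ x, ENNReal.ofReal (energyDensity X q f x) ∂(gibbs ν U) ≤ ENNReal.ofReal E →
      ∫ x, (|f x| - 1) ^ 2 ∂(gibbs ν U) ≤ C * E := by
  obtain ⟨C, hC, hpoin⟩ := h.poincare hP
  refine ⟨4 * C, by positivity, fun f E hf hf2 hf1 hE0 hE => ?_⟩
  have hfc := hf.continuous
  refine le_of_forall_pos_le_add fun ζ hζ => ?_
  set η := ζ / 4 with hη
  have hη0 : 0 < η := by positivity
  set v : M → ℝ := fun x => √(f x ^ 2 + η)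
  have hvc : Continuous v := (hf.sqrt_sq_add hη0).continuous
  have hvsq (x : M) : v x ^ 2 = f x ^ 2 + η := Real.sq_sqrt (by positivity)
  have hv2 : Integrable (fun x => v x ^ 2) (gibbs ν U) :=
    (hf2.integrable_sq.add (integrable_const η)).congr
      (Eventually.of_forall fun x => (hvsq x).symm)
  obtain ⟨k, hk⟩ := hpoin v (hf.sqrt_sq_add hη0)
    ((lintegral_ofReal_ne_top_iff_integrable (by fun_prop)
      (Eventually.of_forall fun x => sq_nonneg _)).2 hv2)
  have hvk : ∫⁻ x, ENNReal.ofReal ((v x - k) ^ 2) ∂(gibbs ν U) ≤ ENNReal.ofReal (C * E) := by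
    rw [ENNReal.ofReal_mul hC.le]
    grw [hk, ← hE, lintegral_ofReal_mono_ae (gibbs_absolutelyContinuous
      (hf.ae_norm_subgrad_sqrt_sq_add_sq_le X hq hη0))]
  obtain ⟨hvki, hvkle⟩ := integrable_of_lintegral_ofReal_le
    (Continuous.aestronglyMeasurable (by fun_prop)) (fun x => sq_nonneg (v x - k))
    (by positivity) hvk
  have hcomp : ∫ x, (|f x| - k) ^ 2 ∂(gibbs ν U) ≤ 2 * (C * E) + 2 * η := by
    have hle : ∫ x, (|f x| - k) ^ 2 ∂(gibbs ν U) ≤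
        ∫ x, (2 * (v x - k) ^ 2 + 2 * η) ∂(gibbs ν U) :=
      integral_mono_of_nonneg (Eventually.of_forall fun x => sq_nonneg _)
        ((hvki.const_mul 2).add (integrable_const _))
        (Eventually.of_forall fun x => abs_sub_sq_le_sqrt_sq_add hη0.le (f x) k)
    rw [integral_add (hvki.const_mul 2) (integrable_const _), integral_const_mul, integral_const,
      probReal_univ, one_smul] at hle
    linarith
  have hone := integral_sub_one_sq_le hf2.norm (fun x => abs_nonneg (f x))
    (by simpa only [Real.norm_eq_abs, sq_abs] using hf1) k
  simp only [Real.norm_eq_abs] at hone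
  linarith

end Confining

lemma LipDiff.ae_norm_subgrad_truncation (X : Fin m → (x : M) → TangentSpace (𝓡 n) x)
    (hf : LipDiff n ν f) (k : ℕ) :
    ∀ᵐ x ∂ν, ‖subgrad X (fun y => truncation k (f y)) x‖ =
      |deriv (truncation k) (f x)| * ‖subgrad X f x‖ := by
  filter_upwards [hf.ae_subgrad_comp X fun _ => (contDiff_truncation k).contDiffAt] with x hx
  rw [hx, norm_smul, Real.norm_eq_abs]

lemma LipDiff.ae_norm_subgrad_truncation_sq_add_le (X : Fin m → (x : M) → TangentSpace (𝓡 n) x)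
    (hf : LipDiff n ν f) (hq : 2 ≤ q) {k : ℕ} (hk : k ≠ 0) {A : ℝ}
    (hA : ∀ t, |deriv (truncation k) t| ≤ A * truncationFactor t ^ k) :
    ∀ᵐ x ∂ν, ‖subgrad X (fun y => truncation k (f y)) x‖ ^ 2 + truncation k (f x) ^ 2 ≤
      (A ^ 2 + 16) * (energyDensity X q f x + (|f x| - 1) ^ 2) := by
  filter_upwards [hf.ae_norm_subgrad_truncation X k] with x hx
  have hder : _ ≤ A ^ 2 * energyDensity X q f x :=
    sq_deriv_truncation_mul_le hq hk hA (f x) ‖subgrad X f x‖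
  rw [hx, mul_pow, sq_abs, ← mul_pow]
  refine (add_le_add hder (sq_truncation_le_abs_sub_one_sq k (f x))).trans ?_
  have h16 : 0 ≤ 16 * energyDensity X q f x := mul_nonneg (by norm_num) (energyDensity_nonneg x)
  have hA2 : 0 ≤ A ^ 2 * (|f x| - 1) ^ 2 := by positivity
  linarith

lemma LipDiff.truncation (hf : LipDiff n ν f) (k : ℕ) : LipDiff n ν fun x => truncation k (f x) :=
  hf.comp fun _ => (contDiff_truncation k).contDiffAt

namespace Confining

variable [BorelSpace M] [ProperSpace M] [IsLocallyFiniteMeasure ν]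

lemma lintegral_truncation_sq_mul_dist_rpow_le (h : Confining X ν x₀ U r) (hq : (r + 1) / r ≤ q)
    {k : ℕ} (hk : q ≤ k) :
    ∃ C : ℝ, 0 < C ∧ ∀ f : M → ℝ, LipDiff n ν f →
      ∫⁻ x, ENNReal.ofReal (energyDensity X q f x + (|f x| - 1) ^ 2) ∂(gibbs ν U) ≠ ⊤ →
      ∫⁻ x, ENNReal.ofReal (truncation k (f x) ^ 2 * dist x₀ x ^ (r + 1)) ∂(gibbs ν U) ≤
        ENNReal.ofReal C *
          ∫⁻ x, ENNReal.ofReal (energyDensity X q f x + (|f x| - 1) ^ 2) ∂(gibbs ν U) := by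
  have hr := h.pos
  have hr2 : 2 ≤ (r + 1) / r := (le_div_iff₀ hr).2 (by linarith [h.le_one])
  have hconj : (r + 1).HolderConjugate ((r + 1) / r) :=
    Real.holderConjugate_iff.2 ⟨by linarith, by field_simp; ring⟩
  have hk0 : k ≠ 0 := by
    rintro rfl
    rw [Nat.cast_zero] at hk
    linarith
  obtain ⟨A, hA, hAb⟩ := exists_abs_deriv_truncation_le k
  obtain ⟨η, C, hη, hC, hweighted⟩ := h.lintegral_sq_mul_dist_rpow_add_one_le
  obtain ⟨D, hD, hyoung⟩ := exists_mul_le_rpow_add_rpow hconj hη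
  set B : ℝ := D * A ^ ((r + 1) / r)
  refine ⟨C * (B + 16), by positivity, fun f hf hfin => ?_⟩
  have henergy := lintegral_ofReal_le_mul (by positivity) (gibbs_absolutelyContinuous (U := U)
    (hf.ae_norm_subgrad_truncation_sq_add_le X (hr2.trans hq) hk0 hAb))
  refine (hweighted _ (fun x => B * energyDensity X q f x) (hf.truncation k) ?_
    (ne_top_of_le_ne_top (ENNReal.mul_ne_top ENNReal.ofReal_ne_top hfin) henergy)).trans ?_
  · filter_upwards [hf.ae_norm_subgrad_truncation X k] with x hx s hs
    rw [hx]
    exact mul_abs_truncation_mul_deriv_le hr2 hq (by linarith) hA hAb hD.le hyoung hs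
      (norm_nonneg _)
  · rw [ENNReal.ofReal_mul hC.le, mul_assoc]
    gcongr
    refine lintegral_ofReal_le_mul (by positivity) (Eventually.of_forall fun x => ?_)
    have hB : 0 ≤ B * (|f x| - 1) ^ 2 := by positivity
    linarith [sq_truncation_le_abs_sub_one_sq k (f x), energyDensity_nonneg (X := X) (q := q)
      (f := f) x]

lemma lintegral_truncation_le (h : Confining X ν x₀ U r) (hq : (r + 1) / r ≤ q) {k : ℕ}
    (hk : q ≤ k) :
    ∃ C : ℝ, 0 < C ∧ ∀ f : M → ℝ, LipDiff n ν f →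
      ∫⁻ x, ENNReal.ofReal (energyDensity X q f x + (|f x| - 1) ^ 2) ∂(gibbs ν U) ≠ ⊤ →
      ∫⁻ x, ENNReal.ofReal (‖subgrad X (fun y => truncation k (f y)) x‖ ^ 2 +
          truncation k (f x) ^ 2 * (1 + dist x₀ x ^ (r + 1))) ∂(gibbs ν U) ≤
        ENNReal.ofReal C *
          ∫⁻ x, ENNReal.ofReal (energyDensity X q f x + (|f x| - 1) ^ 2) ∂(gibbs ν U) := by
  have hq2 : 2 ≤ q := ((le_div_iff₀ h.pos).2 (by linarith [h.le_one])).trans hq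
  have hk0 : k ≠ 0 := by
    rintro rfl
    rw [Nat.cast_zero] at hk
    linarith
  obtain ⟨A, -, hAb⟩ := exists_abs_deriv_truncation_le k
  obtain ⟨C, hC, hweighted⟩ := h.lintegral_truncation_sq_mul_dist_rpow_le hq hk
  refine ⟨(A ^ 2 + 16) + C, by positivity, fun f hf hfin => ?_⟩
  set g : M → ℝ := fun x => _root_.truncation k (f x)
  set J := ∫⁻ x, ENNReal.ofReal (energyDensity X q f x + (|f x| - 1) ^ 2) ∂(gibbs ν U)
  have hgc : Continuous g := (hf.truncation k).continuous
  have hmeas : AEMeasurable (fun x => ENNReal.ofReal (‖subgrad X g x‖ ^ 2 + g x ^ 2))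
      (gibbs ν U) :=
    (((h.aemeasurable_subgrad_gibbs (hf.truncation k)).norm.pow_const 2).add
      (by fun_prop)).ennreal_ofReal
  calc _ ≤ ∫⁻ x, ENNReal.ofReal (‖subgrad X g x‖ ^ 2 + g x ^ 2) ∂(gibbs ν U) +
        ∫⁻ x, ENNReal.ofReal (g x ^ 2 * dist x₀ x ^ (r + 1)) ∂(gibbs ν U) := by
        rw [← lintegral_add_left' hmeas]
        refine lintegral_mono fun x => ?_
        rw [mul_add, mul_one, ← add_assoc]
        exact ENNReal.ofReal_add_le
    _ ≤ ENNReal.ofReal (A ^ 2 + 16) * J + ENNReal.ofReal C * J :=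
        add_le_add (lintegral_ofReal_le_mul (by positivity) (gibbs_absolutelyContinuous (U := U)
          (hf.ae_norm_subgrad_truncation_sq_add_le X hq2 hk0 hAb))) (hweighted f hf hfin)
    _ = ENNReal.ofReal ((A ^ 2 + 16) + C) * J := by
        rw [ENNReal.ofReal_add (p := A ^ 2 + 16) (by positivity) hC.le, add_mul]

lemma lintegral_energyDensity_add_le [IsProbabilityMeasure (gibbs ν U)]
    (h : Confining X ν x₀ U r) (hP : LocalPoincare X ν x₀) (hq : 2 ≤ q) :
    ∃ C : ℝ, 0 < C ∧ ∀ (f : M → ℝ) (E : ℝ), LipDiff n ν f → MemLp f 2 (gibbs ν U) →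
      ∫ x, f x ^ 2 ∂(gibbs ν U) = 1 → 0 ≤ E →
      ∫⁻ x, ENNReal.ofReal (energyDensity X q f x) ∂(gibbs ν U) ≤ ENNReal.ofReal E →
      ∫⁻ x, ENNReal.ofReal (energyDensity X q f x + (|f x| - 1) ^ 2) ∂(gibbs ν U) ≤
        ENNReal.ofReal (C * E) := by
  obtain ⟨C, hC, hone⟩ := h.integral_abs_sub_one_sq_le hP hq
  refine ⟨1 + C, by positivity, fun f E hf hf2 hf1 hE0 hE => ?_⟩
  have hfc := hf.continuous
  have hdev : Integrable (fun x => (|f x| - 1) ^ 2) (gibbs ν U) :=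
    (hf2.norm.sub (memLp_const 1)).integrable_sq
  calc ∫⁻ x, ENNReal.ofReal (energyDensity X q f x + (|f x| - 1) ^ 2) ∂(gibbs ν U)
      ≤ ∫⁻ x, ENNReal.ofReal (energyDensity X q f x) ∂(gibbs ν U) +
          ∫⁻ x, ENNReal.ofReal ((|f x| - 1) ^ 2) ∂(gibbs ν U) := by
        rw [← lintegral_add_right' _ (by fun_prop)]
        exact lintegral_mono fun x => ENNReal.ofReal_add_le
    _ ≤ ENNReal.ofReal E + ENNReal.ofReal (C * E) := by
        rw [← ofReal_integral_eq_lintegral_ofReal hdev (Eventually.of_forall fun x => sq_nonneg _)]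
        grw [hE, hone f E hf hf2 hf1 hE0 hE]
    _ = ENNReal.ofReal ((1 + C) * E) := by
        rw [← ENNReal.ofReal_add hE0 (by positivity), add_mul, one_mul]

end Confining

lemma integral_sq_mul_log_sq_le {α : Type*} [MeasurableSpace α] {μ : Measure α}
    [IsProbabilityMeasure μ] {f : α → ℝ} (hf2 : MemLp f 2 μ) (hf1 : ∫ x, f x ^ 2 ∂μ = 1) (k : ℕ)
    (hg : Integrable (fun x => truncation k (f x) ^ 2 * Real.log (truncation k (f x) ^ 2)) μ) :
    Integrable (fun x => f x ^ 2 * Real.log (f x ^ 2)) μ ∧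
      ∫ x, f x ^ 2 * Real.log (f x ^ 2) ∂μ ≤ 25 * ∫ x, (|f x| - 1) ^ 2 ∂μ +
        ∫ x, truncation k (f x) ^ 2 * Real.log (truncation k (f x) ^ 2) ∂μ := by
  have hlower : Integrable (fun x => f x ^ 2 - 1) μ := hf2.integrable_sq.sub (integrable_const 1)
  have hdev : Integrable (fun x => 25 * (|f x| - 1) ^ 2) μ :=
    (hf2.norm.sub (memLp_const 1)).integrable_sq.const_mul 25
  have hsum : Integrable (fun x => f x ^ 2 - 1 + 25 * (|f x| - 1) ^ 2) μ := hlower.add hdev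
  have hupper : Integrable (fun x => f x ^ 2 - 1 + 25 * (|f x| - 1) ^ 2 +
      truncation k (f x) ^ 2 * Real.log (truncation k (f x) ^ 2)) μ := hsum.add hg
  have hmeas := hf2.aestronglyMeasurable.aemeasurable
  have hint : Integrable (fun x => f x ^ 2 * Real.log (f x ^ 2)) μ :=
    integrable_of_le_of_le (by fun_prop)
      (Eventually.of_forall fun x => Real.self_sub_one_le_mul_log (sq_nonneg (f x)))
      (Eventually.of_forall fun x => sq_mul_log_sq_le k (f x)) hlower hupper
  refine ⟨hint, (integral_mono hint hupper fun x => sq_mul_log_sq_le k (f x)).trans_eq ?_⟩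
  rw [integral_add hsum hg, integral_add hlower hdev,
    integral_sub hf2.integrable_sq (integrable_const 1), hf1, integral_const_mul, integral_const,
    probReal_univ, one_smul, sub_self, zero_add]

namespace Confining

variable [BorelSpace M] [ProperSpace M] [IsLocallyFiniteMeasure ν]
  [IsProbabilityMeasure (gibbs ν U)] {ε α β : ℝ}

lemma integrable_truncation_sq_mul_log (h : Confining X ν x₀ U r) (hε : 0 < ε) (hα : 0 < α)
    (hβ : 0 ≤ β) (hS : ClassicalSobolev X ν ε α β) (hq : (r + 1) / r ≤ q) {k : ℕ} (hk : q ≤ k) :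
    ∃ C : ℝ, 0 < C ∧ ∀ (f : M → ℝ) (E : ℝ), LipDiff n ν f → MemLp f 2 (gibbs ν U) →
      ∫ x, f x ^ 2 ∂(gibbs ν U) = 1 → 0 < E →
      ∫⁻ x, ENNReal.ofReal (energyDensity X q f x + (|f x| - 1) ^ 2) ∂(gibbs ν U) ≤
        ENNReal.ofReal E →
      Integrable (fun x => truncation k (f x) ^ 2 * Real.log (truncation k (f x) ^ 2))
          (gibbs ν U) ∧
        ∫ x, truncation k (f x) ^ 2 * Real.log (truncation k (f x) ^ 2) ∂(gibbs ν U) ≤ C * E := by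
  obtain ⟨A, hA, htrunc⟩ := h.lintegral_truncation_le hq hk
  obtain ⟨D, hD, hdef⟩ := h.defective_logSobolev hε hα hβ hS
  refine ⟨D * A, by positivity, fun f E hf hf2 hf1 hE0 hE => ?_⟩
  have hg1 : ∫ x, truncation k (f x) ^ 2 ∂(gibbs ν U) ≤ 1 :=
    hf1 ▸ integral_mono_of_nonneg (Eventually.of_forall fun x => sq_nonneg _) hf2.integrable_sq
      (Eventually.of_forall fun x => sq_truncation_le k (f x))
  have henergy := htrunc f hf (ne_top_of_le_ne_top ENNReal.ofReal_ne_top hE)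
  grw [hE, ← ENNReal.ofReal_mul hA.le] at henergy
  rw [mul_assoc]
  exact hdef _ (A * E) (hf.truncation k) hg1 (by positivity) henergy

lemma integrable_sq_mul_log_sq (h : Confining X ν x₀ U r) (hP : LocalPoincare X ν x₀) (hε : 0 < ε)
    (hα : 0 < α) (hβ : 0 ≤ β) (hS : ClassicalSobolev X ν ε α β) (hq : (r + 1) / r ≤ q) :
    ∃ C : ℝ, 0 < C ∧ ∀ f : M → ℝ, LipDiff n ν f → MemLp f 2 (gibbs ν U) →
      ∫ x, f x ^ 2 ∂(gibbs ν U) = 1 → Integrable (energyDensity X q f) (gibbs ν U) →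
      Integrable (fun x => f x ^ 2 * Real.log (f x ^ 2)) (gibbs ν U) ∧
        ∫ x, f x ^ 2 * Real.log (f x ^ 2) ∂(gibbs ν U) ≤
          C * ∫ x, energyDensity X q f x ∂(gibbs ν U) := by
  have hq2 : 2 ≤ q := ((le_div_iff₀ h.pos).2 (by linarith [h.le_one])).trans hq
  obtain ⟨k, hk⟩ := exists_nat_ge q
  obtain ⟨A, hA, hone⟩ := h.integral_abs_sub_one_sq_le hP hq2
  obtain ⟨B, hB, hsum⟩ := h.lintegral_energyDensity_add_le hP hq2
  obtain ⟨D, hD, htrunc⟩ := h.integrable_truncation_sq_mul_log hε hα hβ hS hq hk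
  refine ⟨25 * A + D * B, by positivity, fun f hf hf2 hf1 hΓ => ?_⟩
  have hle (E : ℝ) (hE : ∫ x, energyDensity X q f x ∂(gibbs ν U) < E) :
      Integrable (fun x => f x ^ 2 * Real.log (f x ^ 2)) (gibbs ν U) ∧
        ∫ x, f x ^ 2 * Real.log (f x ^ 2) ∂(gibbs ν U) ≤ (25 * A + D * B) * E := by
    have hE0 : 0 < E := (integral_nonneg fun x => energyDensity_nonneg x).trans_lt hE
    have hΓE : ∫⁻ x, ENNReal.ofReal (energyDensity X q f x) ∂(gibbs ν U) ≤ ENNReal.ofReal E := by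
      rw [← ofReal_integral_eq_lintegral_ofReal hΓ
        (Eventually.of_forall fun x => energyDensity_nonneg x)]
      exact ENNReal.ofReal_le_ofReal hE.le
    obtain ⟨hgi, hgle⟩ := htrunc f (B * E) hf hf2 hf1 (by positivity)
      (hsum f E hf hf2 hf1 hE0.le hΓE)
    obtain ⟨hfi, hfle⟩ := integral_sq_mul_log_sq_le hf2 hf1 k hgi
    exact ⟨hfi, by linarith [hone f E hf hf2 hf1 hE0.le hΓE]⟩
  refine ⟨(hle _ (lt_add_one _)).1, ?_⟩
  rw [← div_le_iff₀' (by positivity)]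
  exact le_of_forall_gt_imp_ge_of_dense fun E hE =>
    (div_le_iff₀' (by positivity)).2 (hle E hE).2

end Confining

lemma LipDiff.ae_energyDensity_const_mul (X : Fin m → (x : M) → TangentSpace (𝓡 n) x) (q : ℝ)
    (hf : LipDiff n ν f) {c : ℝ} (hc : 0 < c) :
    ∀ᵐ x ∂ν, energyDensity X q (fun y => c * f y) x = c ^ 2 * energyDensity X q f x := by
  filter_upwards [hf.2] with x hx
  rw [energyDensity, subgrad_comp hx (by simpa using (hasDerivAt_id (f x)).const_mul c),
    norm_smul, Real.norm_of_nonneg hc.le, mul_div_mul_left _ _ hc.ne', energyDensity]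
  ring

lemma Confining.modifiedLogSobolev [BorelSpace M] [ProperSpace M] [IsLocallyFiniteMeasure ν]
    [IsProbabilityMeasure (gibbs ν U)] {ε α β : ℝ} (h : Confining X ν x₀ U r)
    (hP : LocalPoincare X ν x₀) (hε : 0 < ε) (hα : 0 < α) (hβ : 0 ≤ β)
    (hS : ClassicalSobolev X ν ε α β) (hq : (r + 1) / r ≤ q)
    (htest : ∀ f : M → ℝ, IsTestFunction n (gibbs ν U) f → LipDiff n ν f) :
    ModifiedLogSobolev X (gibbs ν U) q := by
  obtain ⟨C, hC, hmain⟩ := h.integrable_sq_mul_log_sq hP hε hα hβ hS hq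
  refine ⟨C, hC, fun f hf hf2 (hΓ : Integrable (energyDensity X q f) (gibbs ν U)) => ?_⟩
  change _ ∧ _ ≤ C * ∫ x, energyDensity X q f x ∂(gibbs ν U)
  set N := ∫ x, f x ^ 2 ∂(gibbs ν U) with hN
  have hN0 : 0 ≤ N := integral_nonneg fun x => sq_nonneg (f x)
  rcases hN0.eq_or_lt with h0 | hpos
  · simp only [← h0, div_zero, Real.log_zero, mul_zero, integral_zero]
    exact ⟨integrable_zero _ _ _,
      mul_nonneg hC.le (integral_nonneg fun x => energyDensity_nonneg x)⟩
  have hc0 : 0 < (√N)⁻¹ := inv_pos.2 (Real.sqrt_pos.2 hpos)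
  have hc2 : (√N)⁻¹ ^ 2 = N⁻¹ := by rw [inv_pow, Real.sq_sqrt hpos.le]
  have hsq (x : M) : ((√N)⁻¹ * f x) ^ 2 = N⁻¹ * f x ^ 2 := by rw [mul_pow, hc2]
  have hscale : ∀ᵐ x ∂(gibbs ν U),
      energyDensity X q (fun y => (√N)⁻¹ * f y) x = N⁻¹ * energyDensity X q f x :=
    hc2 ▸ gibbs_absolutelyContinuous ((htest f hf).ae_energyDensity_const_mul X q hc0)
  obtain ⟨hint, hle⟩ := hmain (fun x => (√N)⁻¹ * f x)
    ((htest f hf).comp (Φ := fun t => (√N)⁻¹ * t) fun _ => by fun_prop) (hf2.const_mul _)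
    (by simp_rw [hsq, integral_const_mul, ← hN, inv_mul_cancel₀ hpos.ne'])
    ((hΓ.const_mul _).congr (hscale.mono fun _ hx => hx.symm))
  have hlog (x : M) : f x ^ 2 * Real.log (f x ^ 2 / N) =
      N * (((√N)⁻¹ * f x) ^ 2 * Real.log (((√N)⁻¹ * f x) ^ 2)) := by
    rw [hsq, ← mul_assoc, mul_inv_cancel_left₀ hpos.ne', inv_mul_eq_div]
  simp_rw [hlog]
  rw [integral_congr_ae hscale, integral_const_mul] at hle
  refine ⟨hint.const_mul N, ?_⟩
  rw [integral_const_mul]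
  refine (mul_le_mul_of_nonneg_left hle hpos.le).trans_eq ?_
  field_simp

end ModifiedLogSobolev

section DistancePower

lemma LipDiff.dist_rpow (hd : LipDiff n ν fun y => dist x₀ y) {p : ℝ} (hp : 1 ≤ p) :
    LipDiff n ν fun x => dist x₀ x ^ p :=
  hd.comp (Φ := fun t => t ^ p) fun _ =>
    (Real.contDiff_rpow_const_of_le (n := 1) (by simpa using hp)).contDiffAt

lemma LipDiff.ae_subgrad_dist_rpow (X : Fin m → (x : M) → TangentSpace (𝓡 n) x)
    (hd : LipDiff n ν fun y => dist x₀ y) {p : ℝ} (hp : 1 ≤ p) :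
    ∀ᵐ x ∂ν, subgrad X (fun y => dist x₀ y ^ p) x =
      (p * dist x₀ x ^ (p - 1)) • subgrad X (fun y => dist x₀ y) x :=
  hd.2.mono fun _ hx =>
    subgrad_comp hx (Φ := fun t => t ^ p) (Real.hasDerivAt_rpow_const (Or.inr hp))

lemma LipDiff.ae_norm_subgrad_rpow_le (hf : LipDiff n ν f) (hf0 : ∀ x, 0 < f x) {s C : ℝ}
    (hs0 : 0 ≤ s) (hs1 : s ≤ 1) (h : ∀ᵐ x ∂ν, ‖subgrad X f x‖ ≤ C * f x ^ (1 - s)) :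
    ∀ᵐ x ∂ν, ‖subgrad X (fun y => f y ^ s) x‖ ≤ C := by
  filter_upwards [hf.2, h] with x hfx hx
  rw [subgrad_comp hfx (Φ := fun t => t ^ s)
    (Real.hasDerivAt_rpow_const (Or.inl (hf0 x).ne')), norm_smul]
  have hpow : 0 < f x ^ (s - 1) := Real.rpow_pos_of_pos (hf0 x) _
  rw [Real.norm_of_nonneg (by positivity)]
  calc s * f x ^ (s - 1) * ‖subgrad X f x‖
      ≤ 1 * f x ^ (s - 1) * (C * f x ^ (1 - s)) := by gcongr
    _ = C * (f x ^ (s - 1) * f x ^ (1 - s)) := by ring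
    _ = C := by rw [← Real.rpow_add (hf0 x), sub_add_sub_cancel', sub_self, Real.rpow_zero, mul_one]

lemma one_add_rpow_le {p d : ℝ} (hp : 1 ≤ p) (hd : 0 ≤ d) :
    (1 + d) ^ p ≤ 2 ^ (p - 1) * (1 + d ^ p) := by
  lift d to ℝ≥0 using hd
  have h := NNReal.rpow_add_le_mul_rpow_add_rpow 1 d hp
  rw [NNReal.one_rpow] at h
  exact_mod_cast h

-- The gradient bound says that `f ^ (1 / p)` is Lipschitz.
lemma exists_le_mul_one_add_dist_rpow {L : ℝ≥0}
    (hL : ∀ x y : M, intrinsicEDist X ν x y ≤ L * edist x y) (x₀ : M) (hf : LipDiff n ν f)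
    (hf0 : ∀ x, 0 < f x) {p C : ℝ} (hp : 1 ≤ p) (hC : 0 < C)
    (h : ∀ᵐ x ∂ν, ‖subgrad X f x‖ ≤ C * f x ^ (1 - p⁻¹)) :
    ∃ A : ℝ, 0 < A ∧ ∀ x, f x ≤ A * (1 + dist x₀ x ^ p) := by
  have hroot : LipDiff n ν fun x => f x ^ p⁻¹ :=
    hf.comp (Φ := fun t => t ^ p⁻¹) fun x => Real.contDiffAt_rpow_const_of_ne (hf0 x).ne'
  have hlip := dist_le_of_norm_subgrad_le hL hroot.isTestFunction hC
    (hf.ae_norm_subgrad_rpow_le hf0 (by positivity) (inv_le_one_of_one_le₀ hp) h)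
  have hroot0 : 0 < f x₀ ^ p⁻¹ := Real.rpow_pos_of_pos (hf0 x₀) _
  set a := f x₀ ^ p⁻¹ + C * L
  have ha : 0 < a := by positivity
  have hgrowth (x : M) : f x ^ p⁻¹ ≤ a * (1 + dist x₀ x) := by
    have hx := (le_abs_self _).trans (hlip x x₀)
    rw [dist_comm] at hx
    have hcross : 0 ≤ f x₀ ^ p⁻¹ * dist x₀ x := by positivity
    have hCL : 0 ≤ C * L := by positivity
    simp only [a]
    linarith
  refine ⟨a ^ p * 2 ^ (p - 1), by positivity, fun x => ?_⟩
  calc f x = (f x ^ p⁻¹) ^ p := (Real.rpow_inv_rpow (hf0 x).le (by positivity)).symm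
    _ ≤ (a * (1 + dist x₀ x)) ^ p :=
        Real.rpow_le_rpow (Real.rpow_nonneg (hf0 x).le _) (hgrowth x) (by positivity)
    _ = a ^ p * (1 + dist x₀ x) ^ p := Real.mul_rpow ha.le (by positivity)
    _ ≤ a ^ p * (2 ^ (p - 1) * (1 + dist x₀ x ^ p)) := by
        gcongr
        exact one_add_rpow_le hp dist_nonneg
    _ = a ^ p * 2 ^ (p - 1) * (1 + dist x₀ x ^ p) := (mul_assoc _ _ _).symm

lemma LipDiff.ae_norm_subgrad_dist_rpow_add_le (hd : LipDiff n ν fun y => dist x₀ y)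
    (hd1 : ∀ᵐ x ∂ν, ‖subgrad X (fun y => dist x₀ y) x‖ ≤ 1) (hf : LipDiff n ν f) {p : ℝ}
    (hp : 1 ≤ p) :
    ∀ᵐ x ∂ν, ‖subgrad X (fun y => dist x₀ y ^ p + f y) x‖ ≤
      p * dist x₀ x ^ (p - 1) + ‖subgrad X f x‖ := by
  filter_upwards [(hd.dist_rpow hp).2, hf.2, hd.ae_subgrad_dist_rpow X hp, hd1]
    with x hdpx hfx hgrad hx
  rw [subgrad_add hdpx hfx, hgrad]
  refine (norm_add_le _ _).trans (add_le_add_left ?_ _)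
  rw [norm_smul, Real.norm_of_nonneg (by positivity)]
  exact mul_le_of_le_one_right (by positivity) hx

lemma exists_dist_rpow_add_le {L : ℝ≥0} (hL : ∀ x y : M, intrinsicEDist X ν x y ≤ L * edist x y)
    (hd : LipDiff n ν fun y => dist x₀ y)
    (hd1 : ∀ᵐ x ∂ν, ‖subgrad X (fun y => dist x₀ y) x‖ ≤ 1) {p δ γ : ℝ} (hp : 1 ≤ p)
    (hδ : 0 ≤ δ) (hγ : 0 ≤ γ) {W : M → ℝ} (hW : LipDiff n ν W)
    (hWg : ∀ᵐ x ∂ν, ‖subgrad X W x‖ ≤ δ * dist x₀ x ^ (p - 1) + γ) :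
    ∃ A : ℝ, 0 < A ∧ ∀ x, dist x₀ x ^ p + W x ≤ A * (1 + dist x₀ x ^ p) := by
  set S : M → ℝ := fun x => dist x₀ x ^ p + √(W x ^ 2 + 1)
  have hroot := hW.sqrt_sq_add one_pos
  have hS1 (x : M) : 1 ≤ S x :=
    le_add_of_nonneg_of_le (by positivity)
      (Real.one_le_sqrt.2 (le_add_of_nonneg_left (sq_nonneg _)))
  have hdS (x : M) : dist x₀ x ^ (p - 1) ≤ S x ^ (1 - p⁻¹) := by
    have hexp : p - 1 = p * (1 - p⁻¹) := by field_simp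
    rw [hexp, Real.rpow_mul dist_nonneg]
    exact Real.rpow_le_rpow (by positivity) (le_add_of_nonneg_right (Real.sqrt_nonneg _))
      (sub_nonneg.2 (inv_le_one_of_one_le₀ hp))
  have hgrad : ∀ᵐ x ∂ν, ‖subgrad X S x‖ ≤ (p + δ + γ) * S x ^ (1 - p⁻¹) := by
    filter_upwards [hd.ae_norm_subgrad_dist_rpow_add_le hd1 hroot hp,
      hW.ae_norm_subgrad_sqrt_sq_add X one_pos, hWg] with x hSx hrootx hWx
    have hWroot := mul_le_of_le_one_left (norm_nonneg (subgrad X W x))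
      (abs_div_sqrt_sq_add_le_one zero_le_one (W x))
    have hS1' : 1 ≤ S x ^ (1 - p⁻¹) :=
      Real.one_le_rpow (hS1 x) (sub_nonneg.2 (inv_le_one_of_one_le₀ hp))
    calc ‖subgrad X S x‖ ≤ p * dist x₀ x ^ (p - 1) + (δ * dist x₀ x ^ (p - 1) + γ * 1) := by
          linarith
      _ ≤ p * S x ^ (1 - p⁻¹) + (δ * S x ^ (1 - p⁻¹) + γ * S x ^ (1 - p⁻¹)) := by
          gcongr <;> exact hdS x
      _ = (p + δ + γ) * S x ^ (1 - p⁻¹) := by ring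
  obtain ⟨A, hA, hSA⟩ := exists_le_mul_one_add_dist_rpow hL x₀ ((hd.dist_rpow hp).add hroot)
    (fun x => one_pos.trans_le (hS1 x)) hp (by positivity) hgrad
  exact ⟨A, hA, fun x => (add_le_add_right (Real.le_sqrt_of_sq_le (by linarith)) _).trans (hSA x)⟩

lemma div_sq_sub_le_inner_smul_add {E : Type*} [NormedAddCommGroup E] [InnerProductSpace ℝ E]
    {a b : E} {σ t B : ℝ} (hσ : 0 < σ) (haσ : 1 / σ ≤ ‖a‖) (ha1 : ‖a‖ ≤ 1) (ht : 0 ≤ t)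
    (hb : ‖b‖ ≤ B) : t / σ ^ 2 - B ≤ inner ℝ a (t • a + b) := by
  have hsq : 1 / σ ^ 2 ≤ ‖a‖ ^ 2 := by
    rw [← one_div_pow]
    exact pow_le_pow_left₀ (by positivity) haσ 2
  have hab : -B ≤ inner ℝ a b := neg_le_of_abs_le <| (abs_real_inner_le_norm a b).trans <|
    (mul_le_of_le_one_left (norm_nonneg b) ha1).trans hb
  rw [inner_add_right, inner_smul_right, real_inner_self_eq_norm_sq, div_eq_mul_one_div]
  linarith [mul_le_mul_of_nonneg_left hsq ht]

lemma lipDiff_dist_of_norm_subgrad_pos (h : ∀ᵐ x ∂ν, 0 < ‖subgrad X (fun y => dist x₀ y) x‖) :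
    LipDiff n ν fun y => dist x₀ y :=
  ⟨(LipschitzWith.dist_right x₀).locallyLipschitz,
    h.mono fun _ hx => mdifferentiableAt_of_subgrad_ne_zero (norm_pos_iff.1 hx)⟩

lemma ae_le_inner_subgrad_dist_rpow_add {σ p δ γ : ℝ} (hσ : 0 < σ)
    (hd : ∀ᵐ x ∂ν, 1 / σ < ‖subgrad X (fun y => dist x₀ y) x‖ ∧
      ‖subgrad X (fun y => dist x₀ y) x‖ ≤ 1) (hp : 1 ≤ p)
    {W : M → ℝ} (hW : LipDiff n ν W)
    (hWg : ∀ᵐ x ∂ν, ‖subgrad X W x‖ ≤ δ * dist x₀ x ^ (p - 1) + γ) :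
    ∀ᵐ x ∂ν, (1 / σ ^ 2 - δ) * dist x₀ x ^ (p - 1) - γ ≤
      inner ℝ (subgrad X (fun y => dist x₀ y) x) (subgrad X (fun y => dist x₀ y ^ p + W y) x) := by
  have hdL : LipDiff n ν fun y => dist x₀ y :=
    lipDiff_dist_of_norm_subgrad_pos (hd.mono fun x hx => (one_div_pos.2 hσ).trans hx.1)
  filter_upwards [(hdL.dist_rpow hp).2, hW.2, hdL.ae_subgrad_dist_rpow X hp, hd, hWg]
    with x hdpx hWx hgrad hdx hWgx
  rw [subgrad_add hdpx hWx, hgrad]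
  refine le_trans ?_ (div_sq_sub_le_inner_smul_add hσ hdx.1.le hdx.2 (by positivity) hWgx)
  have hpow : dist x₀ x ^ (p - 1) ≤ p * dist x₀ x ^ (p - 1) :=
    le_mul_of_one_le_left (by positivity) hp
  calc (1 / σ ^ 2 - δ) * dist x₀ x ^ (p - 1) - γ
      = dist x₀ x ^ (p - 1) / σ ^ 2 - (δ * dist x₀ x ^ (p - 1) + γ) := by ring
    _ ≤ p * dist x₀ x ^ (p - 1) / σ ^ 2 - (δ * dist x₀ x ^ (p - 1) + γ) := by gcongr

lemma confining_dist_rpow_add [IsManifold (𝓡 n) 1 M] [BorelSpace M] [SecondCountableTopology M]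
    (hX : ∀ i, Continuous fun x => (⟨x, X i x⟩ : TangentBundle (𝓡 n) M)) {L : ℝ≥0}
    (hL : ∀ x y : M, intrinsicEDist X ν x y ≤ L * edist x y) {σ K : ℝ} (hσ : 0 < σ) (hK : 0 < K)
    (hd : ∀ᵐ x ∂ν, 1 / σ < ‖subgrad X (fun y => dist x₀ y) x‖ ∧
      ‖subgrad X (fun y => dist x₀ y) x‖ ≤ 1)
    (hΔ : LaplacianLEOn X ν (fun y => dist x₀ y) {x | 1 < dist x₀ x} K)
    {p δ γ : ℝ} (hp : 1 < p) (hp2 : p ≤ 2) (hδ : 0 ≤ δ) (hδσ : δ < 1 / σ ^ 2) (hγ : 0 < γ)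
    {W : M → ℝ} (hW : LipDiff n ν W)
    (hWg : ∀ᵐ x ∂ν, ‖subgrad X W x‖ ≤ δ * dist x₀ x ^ (p - 1) + γ) :
    Confining X ν x₀ (fun x => dist x₀ x ^ p + W x) (p - 1) := by
  have hdL : LipDiff n ν fun y => dist x₀ y :=
    lipDiff_dist_of_norm_subgrad_pos (hd.mono fun x hx => (one_div_pos.2 hσ).trans hx.1)
  have hd1 : ∀ᵐ x ∂ν, ‖subgrad X (fun y => dist x₀ y) x‖ ≤ 1 := hd.mono fun x hx => hx.2
  exact
    { aemeasurable_subgrad := fun f hf => aemeasurable_subgrad hX hf.2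
      pos := sub_pos.2 hp
      le_one := by linarith
      lipDiff_dist := hdL
      norm_subgrad_dist_le := hd1
      laplacian_dist_le := ⟨K, hK, hΔ⟩
      lipDiff := (hdL.dist_rpow hp.le).add hW
      drift := ⟨1 / σ ^ 2 - δ, γ, sub_pos.2 hδσ, hγ,
        ae_le_inner_subgrad_dist_rpow_add hσ hd hp.le hW hWg⟩
      norm_subgrad_le := by
        refine ⟨p + δ + γ, by positivity, ?_⟩
        filter_upwards [hdL.ae_norm_subgrad_dist_rpow_add_le hd1 hW hp.le, hWg] with x hUx hWx
        have hγd : 0 ≤ γ * dist x₀ x ^ (p - 1) := by positivity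
        linarith
      potential_le := by
        simpa only [sub_add_cancel] using exists_dist_rpow_add_le hL hdL hd1 hp.le hδ hγ.le hW hWg }

end DistancePower

end Confinement

lemma tilted_tilted_eq_gibbs {M : Type*} [MeasurableSpace M] {ν : Measure M} {f g : M → ℝ}
    (h : IsProbabilityMeasure ((ν.tilted fun x => -f x).tilted fun x => -g x)) :
    ∃ z : ℝ, (ν.tilted fun x => -f x).tilted (fun x => -g x) =
      gibbs ν fun x => f x + (g x - z) := by
  have hne : (ν.tilted fun x => -f x).tilted (fun x => -g x) ≠ 0 := h.ne_zero
  have hf : Integrable (fun x => Real.exp (-f x)) ν := by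
    by_contra hf
    exact hne (by rw [tilted_of_not_integrable hf, tilted_zero_measure])
  rw [tilted_tilted hf] at hne ⊢
  have hfg : Integrable (fun x => Real.exp (((fun x => -f x) + fun x => -g x) x)) ν := by
    by_contra hfg
    exact hne (tilted_of_not_integrable hfg)
  have hν : NeZero ν := ⟨fun hν0 => hne (by rw [hν0, tilted_zero_measure])⟩
  have hZ := integral_exp_pos hfg
  set Z := ∫ x, Real.exp (((fun x => -f x) + fun x => -g x) x) ∂ν
  refine ⟨-Real.log Z, ?_⟩
  have hdensity (x : M) : Real.exp (-f x + -g x) / Z =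
      Real.exp (-(f x + (g x - -Real.log Z))) := by
    rw [eq_comm, neg_add, neg_sub, neg_sub_left, neg_add', ← add_sub_assoc, Real.exp_sub,
      Real.exp_log hZ]
  simp_rw [Measure.tilted, gibbs, ← hdensity]
  rfl

theorem theorem1_general {n m : ℕ} {M : Type*} [MetricSpace M] [ProperSpace M]
    [ChartedSpace (EuclideanSpace ℝ (Fin n)) M] [IsManifold (𝓡 n) ∞ M]
    [MeasurableSpace M] [BorelSpace M]
    (X : Fin m → (x : M) → TangentSpace (𝓡 n) x)
    (hX : ∀ i, Continuous fun x => (⟨x, X i x⟩ : TangentBundle (𝓡 n) M))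
    (lam : Measure M) [IsLocallyFiniteMeasure lam]
    (L : ℝ≥0) (hL : ∀ x y : M, intrinsicEDist X lam x y ≤ L * edist x y)
    (x₀ : M) (σ K : ℝ) (hσ : 0 < σ) (hK : 0 < K)
    (hd : ∀ᵐ x ∂lam, 1 / σ < ‖subgrad X (fun y => dist x₀ y) x‖ ∧
      ‖subgrad X (fun y => dist x₀ y) x‖ ≤ 1)
    (hΔ : LaplacianLEOn X lam (fun y => dist x₀ y) {x | 1 < dist x₀ x} K)
    (ε α β : ℝ) (hε : 0 < ε) (hα : 0 < α) (hβ : 0 ≤ β)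
    (hS : ClassicalSobolev X lam ε α β) (hP : LocalPoincare X lam x₀)
    (q p : ℝ) (hq : 1 < q) (hp : 1 < p) (hp2 : p ≤ 2) (hqp : q / (q - 1) ≤ p)
    (δ γ : ℝ) (hδ : 0 ≤ δ) (hδσ : δ < 1 / σ ^ 2) (hγ : 0 < γ)
    (W : M → ℝ) (hW : IsTestFunction n lam W)
    (hWg : ∀ᵐ x ∂lam, ‖subgrad X W x‖ ≤ δ * dist x₀ x ^ (p - 1) + γ)
    (hprob : IsProbabilityMeasure ((muP lam x₀ p).tilted fun x => -W x)) :
    ModifiedLogSobolev X ((muP lam x₀ p).tilted fun x => -W x) q := by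
  have hWL : LipDiff n lam W := hW.lipDiff hX hL
  have : IsManifold (𝓡 n) 1 M := .of_le (n := ∞) (by simp)
  unfold muP at hprob ⊢
  obtain ⟨z, hz⟩ := tilted_tilted_eq_gibbs hprob
  rw [hz] at hprob ⊢
  have hWzg : ∀ᵐ x ∂lam, ‖subgrad X (fun y => W y - z) x‖ ≤ δ * dist x₀ x ^ (p - 1) + γ := by
    filter_upwards [hWL.ae_subgrad_sub_const z, hWg] with x hWz hWx
    rwa [hWz]
  have hconf : Confining X lam x₀ (fun x => dist x₀ x ^ p + (W x - z)) (p - 1) :=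
    confining_dist_rpow_add hX hL hσ hK hd hΔ hp hp2 hδ hδσ hγ (hWL.sub_const z) hWzg
  have hpq : (p - 1 + 1) / (p - 1) ≤ q := by
    rw [div_le_iff₀ (sub_pos.2 hq)] at hqp
    rw [div_le_iff₀ (sub_pos.2 hp)]
    linarith
  exact hconf.modifiedLogSobolev hP hε hα hβ hS hpq fun f hf =>
    (hf.lipDiff hX hL).mono_ac (absolutelyContinuous_gibbs hconf.lipDiff.continuous)

theorem theorem1 {n m : ℕ} {M : Type*} [MetricSpace M] [ProperSpace M]
    [ChartedSpace (EuclideanSpace ℝ (Fin n)) M]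
    [IsManifold 𝓘(ℝ, EuclideanSpace ℝ (Fin n)) ∞ M]
    [MeasurableSpace M] [BorelSpace M]
    -- the smooth vector fields that define the (sub)gradient
    (X : Fin m → (x : M) → TangentSpace 𝓘(ℝ, EuclideanSpace ℝ (Fin n)) x)
    (hX : ∀ i, ContMDiff 𝓘(ℝ, EuclideanSpace ℝ (Fin n))
      𝓘(ℝ, EuclideanSpace ℝ (Fin n)).tangent ∞
      (fun x => (⟨x, X i x⟩ : TangentBundle 𝓘(ℝ, EuclideanSpace ℝ (Fin n)) M)))
    (lam : Measure M) (hlam : IsVolume n lam)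
    -- the intrinsic distance of the (sub)gradient is at most a multiple of the distance
    (L : ℝ≥0) (hL : ∀ x y : M, intrinsicEDist X lam x y ≤ L * edist x y)
    (x₀ : M) (σ K : ℝ) (hσ : 1 ≤ σ) (hK : 0 < K)
    (hd : ∀ᵐ x ∂lam, 1 / σ < ‖subgrad X (fun y => dist x₀ y) x‖ ∧
      ‖subgrad X (fun y => dist x₀ y) x‖ ≤ 1)
    (hΔ : LaplacianLEOn X lam (fun y => dist x₀ y) {x | 1 < dist x₀ x} K)
    (ε α β : ℝ) (hε : 0 < ε) (hα : 0 < α) (hβ : 0 < β)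
    (hS : ClassicalSobolev X lam ε α β)
    (hP : LocalPoincare X lam x₀) :
    ∃ δ₀ : ℝ, 0 < δ₀ ∧ δ₀ < 1 ∧
      ∀ q p : ℝ, 2 < q → 1 < p → p < 2 → q / (q - 1) ≤ p →
      ∀ δ γ : ℝ, 0 < δ → δ ≤ δ₀ → 0 < γ →
      ∀ W : M → ℝ, IsTestFunction n lam W →
        (∀ᵐ x ∂lam, ‖subgrad X W x‖ ≤ δ * dist x₀ x ^ (p - 1) + γ) →
        IsProbabilityMeasure ((muP lam x₀ p).tilted fun x => -W x) →
          ModifiedLogSobolev X ((muP lam x₀ p).tilted fun x => -W x) q := by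
  have : IsLocallyFiniteMeasure lam := hlam.isLocallyFiniteMeasure
  have hσ2 : 1 ≤ σ ^ 2 := one_le_pow₀ hσ
  have hhalf : 1 / (2 * σ ^ 2) < 1 / σ ^ 2 := one_div_lt_one_div_of_lt (by positivity) (by linarith)
  exact ⟨1 / (2 * σ ^ 2), by positivity, hhalf.trans_le ((div_le_one₀ (by positivity)).2 hσ2),
    fun q p hq hp hp2 hqp δ γ hδ hδ₀ hγ W hW hWg hprob =>
      theorem1_general X (fun i => (hX i).continuous) lam L hL x₀ σ K (by positivity) hK hd hΔ
        ε α β hε hα hβ.le hS hP q p (by linarith) hp hp2.le hqp δ γ hδ.le (hδ₀.trans_lt hhalf) hγ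
        W hW hWg hprob⟩
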